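/- Let $A=(a_{ij})_{1\le i,j\le r}$ be a symmetric generalized Cartan matrix of hyperbolic type, i.e. $A$ is indecomposable and not positive semidefinite, and every proper principal submatrix of $A$ is positive semidefinite. Let $\mathfrak g=\mathfrak g(A)$ be the complex Kac--Moody algebra generated by $e_i,f_i,h_i$ with the Serre relations, $\mathfrak h=\bigoplus_i\mathbb C h_i$ its Cartan subalgebra, $\mathfrak g_\lambda=\{x\in\mathfrak g: [h_i,x]=\lambda(h_i)x\ \text{for all } i\}$ for $\lambda\in\mathfrak h^*$, $\Delta=\{\lambda\neq 0:\mathfrak g_\lambda\ne 0\}$ the set of roots, $\alpha_j\in\mathfrak h^*$ the simple roots ($\alpha_j(h_i)=a_{ij}$), $\langle\cdot|\cdot\rangle$ the standard invariant symmetric bilinear form ($\langle e_i|f_j\rangle=\delta_{ij}$, $\langle h_i|h_j\rangle=a_{ij}$) and $\omega$ the antilinear Cartan--Chevalley involution ($e_i\mapsto -f_i$, $f_i\mapsto -e_i$, $h_i\mapsto -h_i$). Let $\alpha=\sum_j n^j\alpha_j$ ($n^j\in\mathbb Z_{\ge 0}$) be a positive timelike root, $\alpha^2=\sum_{i,j}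 n^i a_{ij} n^j<0$; put $H(\alpha)=\sum_j n^jh_j$ and $\alpha\cdot\lambda=\lambda(H(\alpha))$ for $\lambda\in\mathfrak h^*$. Let $0\ne E\in\mathfrak g_\alpha$, $F=-\omega(E)$, $N=\langle E|F\rangle$, and $$J_3=\frac{H(\alpha)}{\alpha^2},\qquad J^+=\frac{E}{\sqrt{-N\alpha^2}},\qquad J^-=\frac{F}{\sqrt{-N\alpha^2}} ,$$ so that $J_3,J^\pm$ span (over $\mathbb C$) the subalgebra $\mathfrak{so}(2,1)_\alpha\otimes\mathbb C\subset\mathfrak g$, which acts on $\mathfrak g$ by the adjoint action. A principal (continuous) series representation in $\mathfrak g$ is an irreducible $\mathfrak{so}(2,1)_\alpha\otimes\mathbb C$-submodule $V\subset\mathfrak g$ on which the Casimir operator $J_3J_3-J^+J^--J^-J^+$ is a scalar $s(s-1)$, $s\in\mathbb C$, and on which the spectrum of $J_3$ is unbounded from above and from below (unitarity is not required; the complementary series is included). A weight $\lambda\in\mathfrak h^*$ is said to occur in $V$ if some element of $V$ has a non-zero component in $\mathfrak g_\lambda$. Then: 1. For every $c\in\mathbb R$, the slab $S_c=\{\lambda\in\mathfrak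 h^*: c\le \operatorname{Re}(\alpha\cdot\lambda/\alpha^2)\le c+1\}$ between two hyperplanes orthogonal to $\alpha$ that differ by the translation by $\alpha$ contains only finitely many elements of $\Delta\cup\{0\}$. 2. For every $\beta\in\mathfrak h^*$ and $c\in\mathbb R$ the string $\{\beta+k\alpha: k\in\mathbb Z\}$ meets $S_c$. 3. If $V$ is a principal series representation in $\mathfrak g$, then some weight occurs in $V$, and whenever $\beta$ occurs in $V$, all $\beta+k\alpha$ with $k\in\mathbb Z$ occur in $V$ and lie in $\Delta\cup\{0\}$. If moreover $[\mathfrak h,V]\subset V$, then the weights occurring in $V$ form exactly one full string $\{\beta+k\alpha : k\in\mathbb Z\}$. 4. Principal series representations are finite in number: if $(V_i)_{i\in I}$ is any family of $\mathfrak{so}(2,1)_\alpha\otimes\mathbb C$-submodules of $\mathfrak g$ whose sum is direct (in particular, the summands of any decomposition of $\mathfrak g$), then only finitely many of the $V_i$ are principal series representations. -/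

import Mathlib

open scoped BigOperators

noncomputable section

namespace KacMoody

/-! ### Hyperbolic Cartan matrices -/

/-- A symmetric hyperbolic generalized Cartan matrix: it is indecomposable, of indefinite type, and
every proper principal submatrix is positive semidefinite (for symmetric generalized Cartan
matrices this says that every proper connected subdiagram is of finite or affine type).
Such a matrix is automatically non-degenerate. -/
structure IsHyperbolic {ι : Type*} (A : Matrix ι ι ℤ) : Prop where
  symm : A.IsSymm
  diag : ∀ i, A i i = 2
  offDiag : ∀ i j, i ≠ j → A i j ≤ 0
  indecomposable : ∀ S : Set ι, S.Nonempty → Sᶜ.Nonempty → ∃ i ∈ S, ∃ j ∈ Sᶜ, A i j ≠ 0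
  indefinite : ¬ (A.map (fun z : ℤ => (z : ℝ))).PosSemidef
  proper : ∀ S : Set ι, S ≠ Set.univ →
    ((A.submatrix (fun i : S => (i : ι)) (fun i : S => (i : ι))).map
      (fun z : ℤ => (z : ℝ))).PosSemidef

/-! ### The Kac-Moody algebra, by Chevalley generators and Serre relations -/

section Algebra

variable {ι : Type*} [DecidableEq ι] (A : Matrix ι ι ℤ)

/-- The complex Kac-Moody algebra `𝔤(A)` of a (non-degenerate, symmetric) Cartan matrix:
generators `e i`, `f i`, `h i` and the Serre relations. -/
abbrev KM : Type _ := A.ToLieAlgebra ℂ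

/-- The quotient map from the free Lie algebra on the Chevalley generators. -/
def proj : FreeLieAlgebra ℂ (CartanMatrix.Generators ι) →ₗ[ℂ] KM A :=
  (CartanMatrix.Relations.toIdeal ℂ A).toSubmodule.mkQ

def e (i : ι) : KM A := proj A (FreeLieAlgebra.of ℂ (CartanMatrix.Generators.E i))
def f (i : ι) : KM A := proj A (FreeLieAlgebra.of ℂ (CartanMatrix.Generators.F i))
def h (i : ι) : KM A := proj A (FreeLieAlgebra.of ℂ (CartanMatrix.Generators.H i))

theorem proj_lie (x y : FreeLieAlgebra ℂ (CartanMatrix.Generators ι)) :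
    proj A ⁅x, y⁆ = ⁅proj A x, proj A y⁆ := rfl

theorem proj_eq_zero {x : FreeLieAlgebra ℂ (CartanMatrix.Generators ι)}
    (hx : x ∈ CartanMatrix.Relations.toSet ℂ A) : proj A x = 0 :=
  (Submodule.Quotient.mk_eq_zero _).2 (LieSubmodule.subset_lieSpan hx)

theorem proj_ad_pow (n : ℕ) (x y : FreeLieAlgebra ℂ (CartanMatrix.Generators ι)) :
    proj A ((LieAlgebra.ad ℂ _ x ^ n) y) = (LieAlgebra.ad ℂ (KM A) (proj A x) ^ n) (proj A y) := by
  induction n with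
  | zero => simp
  | succ n ih =>
    rw [pow_succ', pow_succ', Module.End.mul_apply, Module.End.mul_apply, LieAlgebra.ad_apply,
      LieAlgebra.ad_apply, proj_lie, ih]

theorem lie_h_h (i j : ι) : ⁅h A i, h A j⁆ = 0 :=
  proj_eq_zero A (by
    simp only [CartanMatrix.Relations.toSet, Set.mem_union]
    exact Or.inl (Or.inl (Or.inl (Or.inl (Or.inl ⟨(i, j), rfl⟩)))))

theorem lie_e_f (i j : ι) : ⁅e A i, f A j⁆ = if i = j then h A i else 0 := by
  have key := proj_eq_zero A (x := CartanMatrix.Relations.EF ℂ (i, j)) (by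
    simp only [CartanMatrix.Relations.toSet, Set.mem_union]
    exact Or.inl (Or.inl (Or.inl (Or.inl (Or.inr ⟨(i, j), rfl⟩)))))
  by_cases hij : i = j
  · subst hij
    simp only [CartanMatrix.Relations.EF, Function.uncurry_apply_pair, if_true, map_sub,
      Function.comp_apply, proj_lie, sub_eq_zero] at key
    simpa [e, f, h] using key
  · simp only [CartanMatrix.Relations.EF, Function.uncurry_apply_pair, if_neg hij,
      Function.comp_apply, proj_lie] at key
    simpa [e, f, h, hij] using key

theorem lie_h_e (i j : ι) : ⁅h A i, e A j⁆ = A i j • e A j := by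
  have key := proj_eq_zero A (x := CartanMatrix.Relations.HE ℂ A (i, j)) (by
    simp only [CartanMatrix.Relations.toSet, Set.mem_union]
    exact Or.inl (Or.inl (Or.inl (Or.inr ⟨(i, j), rfl⟩))))
  simp only [CartanMatrix.Relations.HE, Function.uncurry_apply_pair, map_sub, map_zsmul,
    Function.comp_apply, proj_lie, sub_eq_zero] at key
  exact key

theorem lie_h_f (i j : ι) : ⁅h A i, f A j⁆ = -(A i j • f A j) := by
  have key := proj_eq_zero A (x := CartanMatrix.Relations.HF ℂ A (i, j)) (by
    simp only [CartanMatrix.Relations.toSet, Set.mem_union]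
    exact Or.inl (Or.inl (Or.inr ⟨(i, j), rfl⟩)))
  simp only [CartanMatrix.Relations.HF, Function.uncurry_apply_pair, map_add, map_zsmul,
    Function.comp_apply, proj_lie] at key
  exact eq_neg_of_add_eq_zero_left key

theorem ad_e_pow (i j : ι) :
    (LieAlgebra.ad ℂ (KM A) (e A i) ^ (-A i j).toNat) ⁅e A i, e A j⁆ = 0 := by
  have key := proj_eq_zero A (x := CartanMatrix.Relations.adE ℂ A (i, j)) (by
    simp only [CartanMatrix.Relations.toSet, Set.mem_union]
    exact Or.inl (Or.inr ⟨(i, j), rfl⟩))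
  simp only [CartanMatrix.Relations.adE, Function.uncurry_apply_pair,
    Function.comp_apply, proj_ad_pow, proj_lie] at key
  exact key

theorem ad_f_pow (i j : ι) :
    (LieAlgebra.ad ℂ (KM A) (f A i) ^ (-A i j).toNat) ⁅f A i, f A j⁆ = 0 := by
  have key := proj_eq_zero A (x := CartanMatrix.Relations.adF ℂ A (i, j)) (by
    simp only [CartanMatrix.Relations.toSet, Set.mem_union]
    exact Or.inr ⟨(i, j), rfl⟩)
  simp only [CartanMatrix.Relations.adF, Function.uncurry_apply_pair,
    Function.comp_apply, proj_ad_pow, proj_lie] at key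
  exact key

/-! ### The antilinear Cartan-Chevalley involution -/

/-- The Lie ring `𝔤(A)` with the conjugate complex structure `z • x := conj z • x`. -/
def ConjKM : Type _ := KM A

instance : LieRing (ConjKM A) := inferInstanceAs (LieRing (KM A))

instance : Module ℂ (ConjKM A) := Module.compHom (KM A) (starRingEnd ℂ)

def toConj : KM A →+ ConjKM A := AddMonoidHom.id (KM A)
def ofConj : ConjKM A →+ KM A := AddMonoidHom.id (KM A)

theorem ofConj_smul (z : ℂ) (x : ConjKM A) :
    ofConj A (z • x) = (starRingEnd ℂ) z • ofConj A x := rfl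

theorem ofConj_lie (x y : ConjKM A) : ofConj A ⁅x, y⁆ = ⁅ofConj A x, ofConj A y⁆ := rfl

theorem ofConj_injective : Function.Injective (ofConj A) := fun _ _ hxy => hxy

theorem ofConj_toConj (x : KM A) : ofConj A (toConj A x) = x := rfl

instance : LieAlgebra ℂ (ConjKM A) where
  lie_smul z x y := ofConj_injective A (by
    rw [ofConj_lie, ofConj_smul, ofConj_smul, ofConj_lie, lie_smul])

/-- The values of the involution on the generators. -/
def omegaGen : CartanMatrix.Generators ι → ConjKM A
  | .E i => toConj A (-f A i)
  | .F i => toConj A (-e A i)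
  | .H i => toConj A (-h A i)

def omegaFree : FreeLieAlgebra ℂ (CartanMatrix.Generators ι) →ₗ⁅ℂ⁆ ConjKM A :=
  FreeLieAlgebra.lift ℂ (omegaGen A)

theorem ofConj_omegaFree_E (i : ι) :
    ofConj A (omegaFree A (FreeLieAlgebra.of ℂ (.E i))) = -f A i := by
  rw [omegaFree, FreeLieAlgebra.lift_of_apply]; rfl

theorem ofConj_omegaFree_F (i : ι) :
    ofConj A (omegaFree A (FreeLieAlgebra.of ℂ (.F i))) = -e A i := by
  rw [omegaFree, FreeLieAlgebra.lift_of_apply]; rfl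

theorem ofConj_omegaFree_H (i : ι) :
    ofConj A (omegaFree A (FreeLieAlgebra.of ℂ (.H i))) = -h A i := by
  rw [omegaFree, FreeLieAlgebra.lift_of_apply]; rfl

theorem ofConj_omegaFree_lie (x y : FreeLieAlgebra ℂ (CartanMatrix.Generators ι)) :
    ofConj A (omegaFree A ⁅x, y⁆) = ⁅ofConj A (omegaFree A x), ofConj A (omegaFree A y)⁆ := by
  rw [LieHom.map_lie, ofConj_lie]

theorem ofConj_omegaFree_ad_pow (n : ℕ) (x y : FreeLieAlgebra ℂ (CartanMatrix.Generators ι)) :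
    ofConj A (omegaFree A ((LieAlgebra.ad ℂ _ x ^ n) y)) =
      (LieAlgebra.ad ℂ (KM A) (ofConj A (omegaFree A x)) ^ n) (ofConj A (omegaFree A y)) := by
  induction n with
  | zero => simp
  | succ n ih =>
    rw [pow_succ', pow_succ', Module.End.mul_apply, Module.End.mul_apply, LieAlgebra.ad_apply,
      LieAlgebra.ad_apply, ofConj_omegaFree_lie, ih]

theorem ad_neg_pow_eq_zero {x y : KM A} {n : ℕ} (hxy : (LieAlgebra.ad ℂ (KM A) x ^ n) y = 0) :
    (LieAlgebra.ad ℂ (KM A) (-x) ^ n) y = 0 := by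
  rw [map_neg, neg_pow, Module.End.mul_apply, hxy, map_zero]

theorem omegaFree_rel {x : FreeLieAlgebra ℂ (CartanMatrix.Generators ι)}
    (hx : x ∈ CartanMatrix.Relations.toSet ℂ A) : omegaFree A x = 0 := by
  apply ofConj_injective A
  rw [map_zero]
  simp only [CartanMatrix.Relations.toSet, Set.mem_union, Set.mem_range, Prod.exists] at hx
  rcases hx with ((((⟨i, j, rfl⟩ | ⟨i, j, rfl⟩) | ⟨i, j, rfl⟩) | ⟨i, j, rfl⟩) | ⟨i, j, rfl⟩) |
    ⟨i, j, rfl⟩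
  · simp [CartanMatrix.Relations.HH, ofConj_omegaFree_lie, ofConj_omegaFree_H, lie_h_h,
      -LieHom.map_lie]
  · by_cases hij : i = j
    · subst hij
      have hfe : ⁅f A i, e A i⁆ = -h A i := by rw [← lie_skew, lie_e_f, if_pos rfl]
      simp [CartanMatrix.Relations.EF, ofConj_omegaFree_lie, ofConj_omegaFree_H,
        ofConj_omegaFree_E, ofConj_omegaFree_F, hfe, -LieHom.map_lie]
    · have hfe : ⁅f A i, e A j⁆ = 0 := by
        rw [← lie_skew, lie_e_f, if_neg (Ne.symm hij), neg_zero]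
      simp [CartanMatrix.Relations.EF, ofConj_omegaFree_lie, hij,
        ofConj_omegaFree_E, ofConj_omegaFree_F, hfe, -LieHom.map_lie]
  · simp [CartanMatrix.Relations.HE, ofConj_omegaFree_lie, ofConj_omegaFree_H,
      ofConj_omegaFree_E, lie_h_f, map_zsmul, -LieHom.map_lie]
  · simp [CartanMatrix.Relations.HF, ofConj_omegaFree_lie, ofConj_omegaFree_H,
      ofConj_omegaFree_F, lie_h_e, map_zsmul, -LieHom.map_lie]
  · simp only [CartanMatrix.Relations.adE, Function.uncurry_apply_pair, Function.comp_apply,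
      ofConj_omegaFree_ad_pow, ofConj_omegaFree_lie, ofConj_omegaFree_E, lie_neg, neg_lie, neg_neg]
    exact ad_neg_pow_eq_zero A (ad_f_pow A i j)
  · simp only [CartanMatrix.Relations.adF, Function.uncurry_apply_pair, Function.comp_apply,
      ofConj_omegaFree_ad_pow, ofConj_omegaFree_lie, ofConj_omegaFree_F, lie_neg, neg_lie, neg_neg]
    exact ad_neg_pow_eq_zero A (ad_e_pow A i j)

theorem toIdeal_le_ker :
    (CartanMatrix.Relations.toIdeal ℂ A).toSubmodule ≤
      LinearMap.ker (omegaFree A : FreeLieAlgebra ℂ (CartanMatrix.Generators ι) →ₗ[ℂ] ConjKM A) := by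
  have hle : CartanMatrix.Relations.toIdeal ℂ A ≤ (omegaFree A).ker :=
    LieSubmodule.lieSpan_le.2 fun x hx => (omegaFree A).mem_ker.2 (omegaFree_rel A hx)
  intro x hx
  exact (omegaFree A).mem_ker.1 (hle hx)

/-- The involution as a linear map into the conjugate Lie algebra. -/
def omegaLin : KM A →ₗ[ℂ] ConjKM A :=
  (CartanMatrix.Relations.toIdeal ℂ A).toSubmodule.liftQ
    (omegaFree A : FreeLieAlgebra ℂ (CartanMatrix.Generators ι) →ₗ[ℂ] ConjKM A) (toIdeal_le_ker A)

/-- The Cartan-Chevalley involution: the antilinear automorphism with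
`e i ↦ -f i`, `f i ↦ -e i`, `h i ↦ -h i`. -/
def omega : KM A →ₛₗ[starRingEnd ℂ] KM A where
  toFun x := ofConj A (omegaLin A x)
  map_add' x y := by rw [map_add, map_add]
  map_smul' z x := by rw [map_smul, ofConj_smul]

theorem omega_e (i : ι) : omega A (e A i) = -f A i := ofConj_omegaFree_E A i
theorem omega_f (i : ι) : omega A (f A i) = -e A i := ofConj_omegaFree_F A i
theorem omega_h (i : ι) : omega A (h A i) = -h A i := ofConj_omegaFree_H A i

theorem omega_lie (x y : KM A) : omega A ⁅x, y⁆ = ⁅omega A x, omega A y⁆ := by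
  obtain ⟨x, rfl⟩ := Submodule.mkQ_surjective _ x
  obtain ⟨y, rfl⟩ := Submodule.mkQ_surjective _ y
  exact ofConj_omegaFree_lie A x y

/-! ### The standard invariant bilinear form -/

/-- The characterization of the standard bilinear form: symmetric, invariant, and normalized by
`⟨e i | f j⟩ = δ i j` and `⟨h i | h j⟩ = A i j`. -/
structure IsStandardForm (B : KM A →ₗ[ℂ] KM A →ₗ[ℂ] ℂ) : Prop where
  symm : ∀ x y, B x y = B y x
  invariant : ∀ x y z, B ⁅x, y⁆ z = B x ⁅y, z⁆
  e_f : ∀ i j, B (e A i) (f A j) = if i = j then 1 else 0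
  h_h : ∀ i j, B (h A i) (h A j) = (A i j : ℂ)

open Classical in
/-- The standard bilinear form `⟨x | y⟩` on `𝔤(A)`, i.e. the form with the defining properties
above. For a non-degenerate symmetric Cartan matrix exactly one such form exists; the value `0` is
only a convention for the other matrices. -/
def standardForm : KM A →ₗ[ℂ] KM A →ₗ[ℂ] ℂ :=
  if hB : ∃ B, IsStandardForm A B then hB.choose else 0

/-! ### Roots

The Cartan subalgebra `𝔥` has the basis `h i`, so `𝔥*` is identified with `ι → ℂ`, the functional
`l` being given by its values `l i = l (h i)`. -/

/-- The eigenspace `𝔤_l = {x | [h i, x] = l (h i) x for all i}`. -/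
def rootSpace (l : ι → ℂ) : Submodule ℂ (KM A) where
  carrier := {x | ∀ i, ⁅h A i, x⁆ = l i • x}
  add_mem' {x y} hx hy i := by rw [lie_add, hx i, hy i, smul_add]
  zero_mem' i := by rw [lie_zero, smul_zero]
  smul_mem' c x hx i := by rw [lie_smul, hx i, smul_comm]

/-- The set of roots `Δ`. -/
def roots : Set (ι → ℂ) := {l | l ≠ 0 ∧ rootSpace A l ≠ ⊥}

variable [Fintype ι]

/-- The element `∑ j, n j • α_j` of the positive root lattice, as a functional:
`α_j (h i) = A i j`. -/
def latticeWeight (n : ι → ℕ) : ι → ℂ := fun i => ∑ j, (A i j : ℂ) * (n j : ℂ)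

/-- `H(α) = ∑ j, n j • h j` for `α = ∑ j, n j • α_j`. -/
def coroot (n : ι → ℕ) : KM A := ∑ j, (n j : ℂ) • h A j

/-- `α² = ∑ n i * A i j * n j` for `α = ∑ j, n j • α_j`. -/
def normSq (n : ι → ℕ) : ℤ := ∑ i, ∑ j, (n i : ℤ) * A i j * (n j : ℤ)

/-- `(α · l) / α²` for `α = ∑ j, n j • α_j` and `l ∈ 𝔥*`, where `α · l = l (H(α))`. -/
def level (n : ι → ℕ) (l : ι → ℂ) : ℂ := (∑ j, (n j : ℂ) * l j) / (normSq A n : ℂ)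

/-- The closed region of `𝔥*` between the hyperplane `α · l = c α²` and its translate by `α`, the
hyperplane `α · l = (c + 1) α²`; both are orthogonal to `α`. -/
def slab (n : ι → ℕ) (c : ℝ) : Set (ι → ℂ) :=
  {l | c ≤ (level A n l).re ∧ (level A n l).re ≤ c + 1}

/-! ### The subalgebra `so(2,1)_α` and its principal series submodules -/

/-- `J₃ = (α²)⁻¹ H(α)`. -/
def J3 (n : ι → ℕ) : KM A := ((normSq A n : ℂ))⁻¹ • coroot A n

/-- `F(α) = -ω(E(α))`. -/
def lowering (E : KM A) : KM A := -omega A E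

/-- `N = ⟨E(α) | F(α)⟩`. It is a positive real number for a non-zero root vector `E(α)`. -/
def pairing (E : KM A) : ℝ := (standardForm A E (lowering A E)).re

/-- The scalar `(-N α²)^(-1/2)`. -/
def scale (n : ι → ℕ) (E : KM A) : ℂ :=
  (((Real.sqrt (-(pairing A E * (normSq A n : ℝ))))⁻¹ : ℝ) : ℂ)

/-- `J⁺ = (-N α²)^(-1/2) E(α)`. -/
def Jplus (n : ι → ℕ) (E : KM A) : KM A := scale A n E • E

/-- `J⁻ = (-N α²)^(-1/2) F(α)`. -/
def Jminus (n : ι → ℕ) (E : KM A) : KM A := scale A n E • lowering A E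

/-- The complexification of `so(2,1)_α`, as a subalgebra of `𝔤(A)`. Its adjoint action makes `𝔤(A)`
a module over it. -/
def so21 (n : ι → ℕ) (E : KM A) : LieSubalgebra ℂ (KM A) :=
  LieSubalgebra.lieSpan ℂ (KM A) {J3 A n, Jplus A n E, Jminus A n E}

/-- The action of the Casimir operator `Ω = J₃ J₃ - J⁺ J⁻ - J⁻ J⁺`. -/
def casimir (n : ι → ℕ) (E x : KM A) : KM A :=
  ⁅J3 A n, ⁅J3 A n, x⁆⁆ - ⁅Jplus A n E, ⁅Jminus A n E, x⁆⁆ - ⁅Jminus A n E, ⁅Jplus A n E, x⁆⁆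

/-- `V` is a principal (continuous) series representation `P_s`: an irreducible
`so(2,1)_α`-submodule on which the Casimir operator is the scalar `s (s - 1)` and on which the
spectrum of `J₃` is unbounded from above and from below. Neither unitarity nor a restriction on the
complex number `s` is imposed, so that the unitary principal series (`s = (1 + i q) / 2`) and the
complementary series are both included. -/
structure IsPrincipalSeries (n : ι → ℕ) (E : KM A) (V : LieSubmodule ℂ (so21 A n E) (KM A))
    (s : ℂ) : Prop where
  irreducible : LieModule.IsIrreducible ℂ (so21 A n E) V
  casimir_eq : ∀ x ∈ V, casimir A n E x = (s * (s - 1)) • x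
  unbounded_above : ∀ R : ℝ, ∃ t : ℝ, R < t ∧ ∃ x ∈ V, x ≠ 0 ∧ ⁅J3 A n, x⁆ = (t : ℂ) • x
  unbounded_below : ∀ R : ℝ, ∃ t : ℝ, t < R ∧ ∃ x ∈ V, x ≠ 0 ∧ ⁅J3 A n, x⁆ = (t : ℂ) • x

/-- The weights that occur in a subspace `V`: those `l ∈ 𝔥*` for which some element of `V` has a
non-zero component in `𝔤_l`, i.e. for which `V` is not contained in the sum of the other
eigenspaces. -/
def weightsOf (V : Submodule ℂ (KM A)) : Set (ι → ℂ) :=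
  {l | ¬ V ≤ ⨆ m : {m : ι → ℂ // m ≠ l}, rootSpace A m.1}

end Algebra

end KacMoody

end

/-!
The quadratic form of a hyperbolic Cartan matrix `A` is non-negative on every lattice vector with a
vanishing coordinate, because such a vector lives on a proper principal submatrix. For the timelike
vector `α = ∑ n i • α_i` and any `x` in the root lattice, `n i x - x i α` is such a vector, so that
`-α² (x i)² ≤ (n i)² x² - 2 n i (x i) (α · x)` for every `i` (`IsHyperbolic.coord_inequality`). This
one inequality replaces the signature of `A`. It shows that `A` is non-degenerate, so that the
degree in the root lattice is determined by the weight, and that only finitely many `x` have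
`x² ≤ 2` and bounded `α · x`.

The algebra `𝔤` is spanned by the `h i` and by iterated brackets in the `e i` and in the `f i`
(`triangular_eq_top`). Hence it is the direct sum of finite-dimensional weight spaces, with weights
in the root lattice whose coordinates have one sign, and its zero weight space is `𝔥`. The Serre
relations make `ad (e i)` locally nilpotent, so simple reflections map roots to roots. Lowering the
height of a positive root in this way leads to a simple root, of norm `2`, or to a root that has no
positive product with a simple root occurring in it, whose norm is therefore at most `0`. So every
root has norm at most `2` (`latticeForm_self_le_two_of_nonneg`), and slabs contain finitely many.

In a principal series representation `V` a `J₃`-eigenvector killed by `J⁺` or by `J⁻` would generate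
a submodule with half-bounded spectrum, that is, all of `V`. So neither operator kills an
eigenvector, and since the Casimir operator and `[J⁺, J⁻] = -J₃` make `J⁻ J⁺` and `J⁺ J⁻` scalars
on each `J₃`-eigenspace of `V`, these scalars do not vanish. As the operators are homogeneous, they
then cannot kill any weight component of an eigenvector in `V`, and the weights of `V` form full
strings. The relation `[J⁺, J⁻] = -J₃` comes from the invariance of the form and `𝔤_0 = 𝔥`. Neither
existence nor positivity of the form is needed separately: the normalization factor of `J⁺` and
`J⁻` is non-zero whenever there is a principal series at all (`IsPrincipalSeries.scale_ne_zero`),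
and this makes the form exist and `N` positive.

Finally, the spectrum of `J₃` on `V` meets `[0, 1]`, so every principal series contains a non-zero
vector in the sum of the weight spaces of a slab. This sum is finite-dimensional, and vectors in
different summands of a direct sum are linearly independent.
-/

open scoped BigOperators

namespace KacMoody

/-! ### Simultaneous eigenvectors -/

section Eigenvectors

variable {κ M : Type*} [AddCommGroup M] [Module ℂ M]

/-- A subspace that is stable under a family of operators contains, with a sum of simultaneous
eigenvectors for pairwise different eigenvalue systems, each of the summands. -/
theorem mem_of_sum_eigenvectors_mem (T : κ → Module.End ℂ M) (p : Submodule ℂ M)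
    (hp : ∀ i, ∀ x ∈ p, T i x ∈ p) (S : Finset (κ → ℂ)) (z : (κ → ℂ) → M)
    (hz : ∀ l ∈ S, ∀ i, T i (z l) = l i • z l) (hsum : ∑ l ∈ S, z l ∈ p) :
    ∀ l ∈ S, z l ∈ p := by
  classical
  induction S using Finset.induction_on generalizing z with
  | empty => simp
  | insert m S hm ih =>
    have key : ∀ l ∈ S, z l ∈ p := by
      intro l hl
      obtain ⟨i, hi⟩ : ∃ i, l i ≠ m i := by
        by_contra! hlm
        exact hm (funext hlm ▸ hl)
      have h1 : ∑ k ∈ S, (k i - m i) • z k ∈ p := by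
        have h2 := p.sub_mem (hp i _ hsum) (p.smul_mem (m i) hsum)
        rw [Finset.sum_insert hm, map_add, map_sum, smul_add, Finset.smul_sum,
          hz m (Finset.mem_insert_self m S) i, add_sub_add_left_eq_sub,
          ← Finset.sum_sub_distrib] at h2
        rwa [Finset.sum_congr rfl fun k hk => by
          rw [hz k (Finset.mem_insert_of_mem hk) i, ← sub_smul]] at h2
      have h3 := ih (fun k => (k i - m i) • z k) (fun k hk j => by
        rw [map_smul, hz k (Finset.mem_insert_of_mem hk) j, smul_comm]) h1 l hl
      exact (p.smul_mem_iff (sub_ne_zero.2 hi)).1 h3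
    intro l hl
    rcases Finset.mem_insert.1 hl with rfl | hl
    · rw [Finset.sum_insert hm] at hsum
      exact (p.add_mem_iff_left (p.sum_mem key)).1 hsum
    · exact key l hl

/-- An eigenvector in the span of eigenvectors shares its eigenvalue with one of them. -/
theorem exists_eigenvalue_eq_of_mem_span {σ : Type*} (T : Module.End ℂ M) (v : σ → M) (t : σ → ℂ)
    (hv : ∀ k, T (v k) = t k • v k) {x : M} (hx : x ∈ Submodule.span ℂ (Set.range v)) (hx0 : x ≠ 0)
    {a : ℂ} (hxa : T x = a • x) : ∃ k, a = t k := by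
  by_contra! hne
  have hle : Submodule.span ℂ (Set.range v) ≤ ⨆ b : {b : ℂ // b ≠ a}, T.eigenspace b.1 := by
    refine Submodule.span_le.2 ?_
    rintro _ ⟨k, rfl⟩
    exact Submodule.mem_iSup_of_mem (p := fun b : {b : ℂ // b ≠ a} => T.eigenspace b.1)
      ⟨t k, (hne k).symm⟩ (Module.End.mem_eigenspace_iff.2 (hv k))
  have hd := T.eigenspaces_iSupIndep a
  rw [iSup_subtype'] at hd
  exact hx0 ((Submodule.disjoint_def.1 hd) x (Module.End.mem_eigenspace_iff.2 hxa) (hle hx))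

end Eigenvectors

/-! ### Locally nilpotent `sl₂`-actions -/

section SlTwo

variable {M : Type*} [AddCommGroup M] [Module ℂ M] {X Y H : Module.End ℂ M}

theorem weight_pow_lowering (hHY : ∀ v, H (Y v) = Y (H v) - (2 : ℂ) • Y v) {v : M} {μ : ℂ}
    (hv : H v = μ • v) (k : ℕ) : H ((Y ^ k) v) = (μ - 2 * k) • (Y ^ k) v := by
  induction k with
  | zero => simpa using hv
  | succ k ih =>
    rw [pow_succ', Module.End.mul_apply, hHY, ih, map_smul, ← sub_smul]
    congr 1
    push_cast
    ring

theorem raising_pow_lowering (hXY : ∀ v, X (Y v) = Y (X v) + H v)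
    (hHY : ∀ v, H (Y v) = Y (H v) - (2 : ℂ) • Y v) {v : M} {μ : ℂ} (hv : H v = μ • v) (k : ℕ) :
    X ((Y ^ (k + 1)) v) = (Y ^ (k + 1)) (X v) + ((k + 1) * (μ - k)) • (Y ^ k) v := by
  induction k with
  | zero => simp [hXY, hv]
  | succ k ih =>
    rw [pow_succ' Y (k + 1), Module.End.mul_apply, hXY, ih, weight_pow_lowering hHY hv,
      Module.End.mul_apply, map_add, map_smul, add_assoc, ← Module.End.mul_apply Y (Y ^ k),
      ← Module.End.mul_apply Y (Y ^ (k + 1)), ← pow_succ', ← pow_succ', ← add_smul]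
    congr 2
    push_cast
    ring

/-- Where the raising operator is locally nilpotent, the lowering operator to the power `m` is
injective on vectors of weight `m`. Induction on the order of nilpotency: the vector `X v` has
weight `m + 2` and is killed by `Y ^ (m + 2)`, hence vanishes, so that `v` is primitive. -/
theorem eq_zero_of_pow_lowering_eq_zero (hXY : ∀ v, X (Y v) = Y (X v) + H v)
    (hHY : ∀ v, H (Y v) = Y (H v) - (2 : ℂ) • Y v) (hHX : ∀ v, H (X v) = X (H v) + (2 : ℂ) • X v)
    (r : ℕ) (v : M) (m : ℕ) (hr : (X ^ r) v = 0) (hv : H v = (m : ℂ) • v)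
    (hm : (Y ^ m) v = 0) : v = 0 := by
  induction r generalizing v m with
  | zero => simpa using hr
  | succ r ih =>
    -- The commutator of `X` and `Y ^ (m + 2)` contributes a multiple of `Y ^ (m + 1) v = 0`.
    have hXv : X v = 0 := by
      refine ih (X v) (m + 2) (by rwa [pow_succ, Module.End.mul_apply] at hr) ?_ ?_
      · rw [hHX, hv, map_smul, ← add_smul]
        push_cast
        rfl
      · have h1 := raising_pow_lowering hXY hHY hv (m + 1)
        have h2 : (Y ^ (m + 1)) v = 0 := by rw [pow_succ', Module.End.mul_apply, hm, map_zero]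
        have h3 : (Y ^ (m + 1 + 1)) v = 0 := by rw [pow_succ', Module.End.mul_apply, h2, map_zero]
        rw [h2, h3, map_zero, smul_zero, add_zero] at h1
        exact h1.symm
    have key : ∀ k, k ≤ m → (Y ^ k) v = 0 → v = 0 := by
      intro k
      induction k with
      | zero => intro _ h; simpa using h
      | succ k ihk =>
        intro hk h
        have h1 := raising_pow_lowering hXY hHY hv k
        rw [h, hXv, map_zero, map_zero, zero_add] at h1
        refine ihk (by omega) ((smul_eq_zero.1 h1.symm).resolve_left (mul_ne_zero ?_ ?_))
        · exact_mod_cast k.succ_ne_zero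
        · rw [sub_ne_zero]
          exact_mod_cast (by omega : m ≠ k)
    exact key m le_rfl hm

end SlTwo

/-! ### The quadratic form of a hyperbolic Cartan matrix -/

section Form

open Matrix

variable {ι : Type*} [Fintype ι] (A : Matrix ι ι ℤ)

/-- The bilinear form on the root lattice `ℤ^ι` with Gram matrix `A`. -/
def latticeForm (b c : ι → ℤ) : ℤ := b ⬝ᵥ A *ᵥ c

/-- The element `∑ j, b j • α_j` of the root lattice as a functional on `𝔥`. -/
def zWeight : (ι → ℤ) →+ (ι → ℂ) where
  toFun b i := ((A *ᵥ b) i : ℤ)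
  map_zero' := by ext; simp
  map_add' b c := by ext; simp [Matrix.mulVec_add]

theorem zWeight_apply (b : ι → ℤ) (i : ι) : zWeight A b i = ((A *ᵥ b) i : ℤ) := rfl

theorem latticeForm_symm (hA : A.IsSymm) (b c : ι → ℤ) : latticeForm A b c = latticeForm A c b := by
  rw [latticeForm, latticeForm, dotProduct_comm, ← vecMul_transpose, hA.eq, dotProduct_mulVec]

theorem normSq_eq_latticeForm (n : ι → ℕ) :
    normSq A n = latticeForm A (fun j => (n j : ℤ)) (fun j => (n j : ℤ)) := by
  simp only [normSq, latticeForm, dotProduct, mulVec, Finset.mul_sum, mul_assoc]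

theorem latticeWeight_eq_zWeight (n : ι → ℕ) :
    latticeWeight A n = zWeight A (fun j => (n j : ℤ)) := by
  ext i
  simp [latticeWeight, zWeight_apply, mulVec, dotProduct]

theorem level_zWeight (n : ι → ℕ) (b : ι → ℤ) :
    level A n (zWeight A b) = (latticeForm A (fun j => (n j : ℤ)) b : ℂ) / (normSq A n : ℂ) := by
  simp [level, latticeForm, zWeight_apply, dotProduct]

variable {A}

theorem IsHyperbolic.latticeForm_nonneg (hA : IsHyperbolic A) {y : ι → ℤ} {i : ι} (hi : y i = 0) :
    0 ≤ latticeForm A y y := by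
  classical
  have hS : ({j | j ≠ i} : Set ι) ≠ Set.univ := fun h => (h ▸ Set.mem_univ i : i ∈ {j | j ≠ i}) rfl
  have h1 := (hA.proper _ hS).dotProduct_mulVec_nonneg (fun j => (y j : ℝ))
  -- The omitted index contributes nothing, as the coordinate of `y` vanishes there.
  have h2 : ∀ g : ι → ℝ, g i = 0 → ∑ j : ({j | j ≠ i} : Set ι), g j = ∑ j, g j := by
    intro g hg
    rw [← Finset.sum_erase Finset.univ hg]
    exact (Finset.sum_subtype (Finset.univ.erase i) (fun j => by simp) g).symm
  simp only [dotProduct, mulVec, star_trivial, Matrix.map_apply, submatrix_apply] at h1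
  have h3 : ∀ k, ∑ j : ({j | j ≠ i} : Set ι), (A k j : ℝ) * (y j : ℝ) =
      ∑ j, (A k j : ℝ) * (y j : ℝ) := fun k => h2 (fun j => (A k j : ℝ) * y j) (by simp [hi])
  simp only [h3] at h1
  rw [h2 (fun k => (y k : ℝ) * ∑ j, (A k j : ℝ) * y j) (by simp [hi])] at h1
  simp only [latticeForm, dotProduct, mulVec]
  exact_mod_cast h1

/-- The Lorentzian geometry of a hyperbolic matrix in one inequality: the vector `n i x - x i n`
has a vanishing coordinate, so that its norm is not negative. -/
theorem IsHyperbolic.coord_inequality (hA : IsHyperbolic A) (n x : ι → ℤ) (i : ι) :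
    -(latticeForm A n n) * x i ^ 2 ≤
      n i ^ 2 * latticeForm A x x - 2 * n i * x i * latticeForm A n x := by
  have h := hA.latticeForm_nonneg (y := n i • x - x i • n) (i := i) (by simp [mul_comm])
  have hs := latticeForm_symm A hA.symm x n
  simp only [latticeForm, mulVec_sub, mulVec_smul, dotProduct_sub, sub_dotProduct, smul_dotProduct,
    dotProduct_smul, smul_eq_mul] at h hs ⊢
  rw [hs] at h
  linarith

theorem IsHyperbolic.zWeight_injective (hA : IsHyperbolic A) {n : ι → ℤ}
    (hn : latticeForm A n n < 0) : Function.Injective (zWeight A) := by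
  refine (injective_iff_map_eq_zero _).2 fun x hx => ?_
  have h0 : A *ᵥ x = 0 := by
    ext i
    have := congrFun hx i
    rw [zWeight_apply, Pi.zero_apply] at this
    exact_mod_cast this
  ext i
  have h1 := hA.coord_inequality n x i
  simp only [latticeForm, h0, dotProduct_zero, mul_zero, sub_zero] at h1 hn
  have h2 : x i ^ 2 ≤ 0 := by nlinarith [sq_nonneg (x i)]
  simpa using le_antisymm h2 (sq_nonneg _)

/-- Only finitely many lattice vectors of bounded norm have a bounded product with a given timelike
vector. -/
theorem IsHyperbolic.finite_bounded (hA : IsHyperbolic A) {n : ι → ℤ}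
    (hn : latticeForm A n n < 0) (C : ℤ) :
    {x : ι → ℤ | latticeForm A x x ≤ 2 ∧ |latticeForm A n x| ≤ C}.Finite := by
  classical
  refine (Set.finite_Icc (fun i => -(2 * n i ^ 2 + 2 * |n i| * C))
    (fun i => 2 * n i ^ 2 + 2 * |n i| * C)).subset ?_
  rintro x ⟨h2, hC⟩
  have hx : ∀ i, |x i| ≤ 2 * n i ^ 2 + 2 * |n i| * C := by
    intro i
    have h1 := hA.coord_inequality n x i
    have h3 : -(2 * n i * x i * latticeForm A n x) ≤ 2 * |n i| * |x i| * C := by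
      refine (neg_le_abs _).trans ?_
      rw [abs_mul, abs_mul, abs_mul, abs_two]
      gcongr
    have hC0 := (abs_nonneg _).trans hC
    rcases (abs_nonneg (x i)).eq_or_lt with h0 | h0
    · rw [← h0]
      positivity
    · have h4 : |x i| ^ 2 ≤ |x i| * (2 * n i ^ 2 + 2 * |n i| * C) := by
        have h5 : n i ^ 2 * latticeForm A x x ≤ n i ^ 2 * 2 := by gcongr
        have h6 : n i ^ 2 * 2 ≤ |x i| * (2 * n i ^ 2) := by nlinarith [sq_nonneg (n i)]
        have h7 : x i ^ 2 ≤ -(latticeForm A n n) * x i ^ 2 := by nlinarith [sq_nonneg (x i)]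
        rw [sq_abs]
        linarith
      rw [pow_two] at h4
      exact le_of_mul_le_mul_left h4 h0
  exact ⟨fun i => (abs_le.1 (hx i)).1, fun i => (abs_le.1 (hx i)).2⟩

end Form

/-! ### The triangular decomposition -/

section Words

variable {ι L : Type*} [LieRing L]

/-- The iterated bracket `[x j₁, [x j₂, … [x jₖ, x i]]]` for the word `w = [j₁, …, jₖ]`. -/
def word (x : ι → L) (i : ι) (w : List ι) : L := w.foldr (fun j y => ⁅x j, y⁆) (x i)

/-- The relations between the Chevalley generators that do not involve the Serre relations. They
are symmetric under `(e, f, h) ↦ (f, e, -h)`, which exchanges the two triangular parts. -/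
structure ChevalleyRelations [DecidableEq ι] (A : Matrix ι ι ℤ) (e f h : ι → L) : Prop where
  lie_h_h : ∀ i j, ⁅h i, h j⁆ = 0
  lie_e_f : ∀ i j, ⁅e i, f j⁆ = if i = j then h i else 0
  lie_h_e : ∀ i j, ⁅h i, e j⁆ = A i j • e j
  lie_h_f : ∀ i j, ⁅h i, f j⁆ = -(A i j • f j)

namespace ChevalleyRelations

variable [DecidableEq ι] {A : Matrix ι ι ℤ} {e f h : ι → L}

theorem swap (R : ChevalleyRelations A e f h) : ChevalleyRelations A f e (fun i => -h i) where
  lie_h_h i j := by rw [neg_lie, lie_neg, R.lie_h_h, neg_zero, neg_zero]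
  lie_e_f i j := by
    rw [← lie_skew, R.lie_e_f]
    by_cases hij : i = j
    · subst hij; simp
    · simp [hij, Ne.symm hij]
  lie_h_e i j := by rw [neg_lie, R.lie_h_f, neg_neg]
  lie_h_f i j := by rw [neg_lie, R.lie_h_e]

theorem lie_h_word (R : ChevalleyRelations A e f h) (k i : ι) (w : List ι) :
    ⁅h k, word e i w⁆ = ((i :: w).map (A k)).sum • word e i w := by
  induction w with
  | nil => simp [word, R.lie_h_e]
  | cons j w ih =>
    change ⁅h k, ⁅e j, word e i w⁆⁆ = _ • ⁅e j, word e i w⁆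
    rw [leibniz_lie, R.lie_h_e, ih, smul_lie, lie_smul, ← add_smul]
    simp only [List.map_cons, List.sum_cons]
    congr 1
    ring

end ChevalleyRelations

variable [LieAlgebra ℂ L]

/-- The span of all iterated brackets in the family `x`. -/
def wordSpan (x : ι → L) : Submodule ℂ L :=
  Submodule.span ℂ (Set.range fun p : ι × List ι => word x p.1 p.2)

theorem word_mem_wordSpan (x : ι → L) (i : ι) (w : List ι) : word x i w ∈ wordSpan x :=
  Submodule.subset_span ⟨(i, w), rfl⟩

theorem lie_mem_wordSpan (x : ι → L) (j : ι) {y : L} (hy : y ∈ wordSpan x) :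
    ⁅x j, y⁆ ∈ wordSpan x := by
  induction hy using Submodule.span_induction with
  | mem y hy =>
    obtain ⟨⟨i, w⟩, rfl⟩ := hy
    exact word_mem_wordSpan x i (j :: w)
  | zero => simp
  | add y z _ _ hy hz => rw [lie_add]; exact add_mem hy hz
  | smul c y _ hy => rw [lie_smul]; exact Submodule.smul_mem _ c hy

theorem span_range_neg (h : ι → L) : Submodule.span ℂ (Set.range fun i => -h i) =
    Submodule.span ℂ (Set.range h) := by
  rw [← Submodule.span_neg (Set.range h)]
  congr 1
  ext x
  simp [neg_eq_iff_eq_neg]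

namespace ChevalleyRelations

variable [DecidableEq ι] {A : Matrix ι ι ℤ} {e f h : ι → L}

theorem lie_e_cartan (R : ChevalleyRelations A e f h) (j : ι) {y : L}
    (hy : y ∈ Submodule.span ℂ (Set.range h)) : ⁅e j, y⁆ ∈ wordSpan e := by
  induction hy using Submodule.span_induction with
  | mem y hy =>
    obtain ⟨i, rfl⟩ := hy
    rw [← lie_skew, R.lie_h_e]
    exact neg_mem (zsmul_mem (word_mem_wordSpan e j []) _)
  | zero => simp
  | add y z _ _ hy hz => rw [lie_add]; exact add_mem hy hz
  | smul c y _ hy => rw [lie_smul]; exact Submodule.smul_mem _ c hy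

theorem lie_h_cartan (R : ChevalleyRelations A e f h) (j : ι) {y : L}
    (hy : y ∈ Submodule.span ℂ (Set.range h)) : ⁅h j, y⁆ = 0 := by
  induction hy using Submodule.span_induction with
  | mem y hy => obtain ⟨i, rfl⟩ := hy; exact R.lie_h_h j i
  | zero => simp
  | add y z _ _ hy hz => rw [lie_add, hy, hz, add_zero]
  | smul c y _ hy => rw [lie_smul, hy, smul_zero]

theorem lie_h_wordSpan (R : ChevalleyRelations A e f h) (j : ι) {y : L} (hy : y ∈ wordSpan e) :
    ⁅h j, y⁆ ∈ wordSpan e := by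
  induction hy using Submodule.span_induction with
  | mem y hy =>
    obtain ⟨⟨i, w⟩, rfl⟩ := hy
    dsimp only
    rw [R.lie_h_word]
    exact zsmul_mem (word_mem_wordSpan e i w) _
  | zero => simp
  | add y z _ _ hy hz => rw [lie_add]; exact add_mem hy hz
  | smul c y _ hy => rw [lie_smul]; exact Submodule.smul_mem _ c hy

theorem lie_f_word (R : ChevalleyRelations A e f h) (k i : ι) (w : List ι) :
    ⁅f k, word e i w⁆ ∈ wordSpan e ⊔ Submodule.span ℂ (Set.range h) := by
  have hfe : ∀ j, ⁅f k, e j⁆ = -(if j = k then h j else 0) := fun j => by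
    rw [← lie_skew, R.lie_e_f]
  induction w with
  | nil =>
    change ⁅f k, e i⁆ ∈ _
    rw [hfe]
    split_ifs
    · exact neg_mem (Submodule.mem_sup_right (Submodule.subset_span ⟨i, rfl⟩))
    · simp
  | cons j w ih =>
    change ⁅f k, ⁅e j, word e i w⁆⁆ ∈ _
    rw [leibniz_lie, hfe]
    refine add_mem (Submodule.mem_sup_left ?_) (Submodule.mem_sup_left ?_)
    · split_ifs
      · rw [neg_lie]
        exact neg_mem (R.lie_h_wordSpan j (word_mem_wordSpan e i w))
      · simp
    · obtain ⟨y, hy, z, hz, hyz⟩ := Submodule.mem_sup.1 ih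
      rw [← hyz, lie_add]
      exact add_mem (lie_mem_wordSpan e j hy) (R.lie_e_cartan j hz)

theorem lie_f_wordSpan (R : ChevalleyRelations A e f h) (k : ι) {y : L} (hy : y ∈ wordSpan e) :
    ⁅f k, y⁆ ∈ wordSpan e ⊔ Submodule.span ℂ (Set.range h) := by
  induction hy using Submodule.span_induction with
  | mem y hy => obtain ⟨⟨i, w⟩, rfl⟩ := hy; exact R.lie_f_word k i w
  | zero => simp
  | add y z _ _ hy hz => rw [lie_add]; exact add_mem hy hz
  | smul c y _ hy => rw [lie_smul]; exact Submodule.smul_mem _ c hy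

theorem lie_e_triangular (R : ChevalleyRelations A e f h) (k : ι) {y : L}
    (hy : y ∈ wordSpan f ⊔ Submodule.span ℂ (Set.range h) ⊔ wordSpan e) :
    ⁅e k, y⁆ ∈ wordSpan f ⊔ Submodule.span ℂ (Set.range h) ⊔ wordSpan e := by
  obtain ⟨_, hxy, z, hz, rfl⟩ := Submodule.mem_sup.1 hy
  obtain ⟨x, hx, y, hy', rfl⟩ := Submodule.mem_sup.1 hxy
  rw [lie_add, lie_add]
  refine add_mem (add_mem (Submodule.mem_sup_left ?_) (Submodule.mem_sup_right ?_))
    (Submodule.mem_sup_right (lie_mem_wordSpan e k hz))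
  · have := R.swap.lie_f_wordSpan k hx
    rwa [span_range_neg] at this
  · exact R.lie_e_cartan k hy'

theorem lie_h_triangular (R : ChevalleyRelations A e f h) (k : ι) {y : L}
    (hy : y ∈ wordSpan f ⊔ Submodule.span ℂ (Set.range h) ⊔ wordSpan e) :
    ⁅h k, y⁆ ∈ wordSpan f ⊔ Submodule.span ℂ (Set.range h) ⊔ wordSpan e := by
  obtain ⟨_, hxy, z, hz, rfl⟩ := Submodule.mem_sup.1 hy
  obtain ⟨x, hx, y, hy', rfl⟩ := Submodule.mem_sup.1 hxy
  rw [lie_add, lie_add, R.lie_h_cartan k hy', add_zero]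
  refine add_mem (Submodule.mem_sup_left (Submodule.mem_sup_left ?_))
    (Submodule.mem_sup_right (R.lie_h_wordSpan k hz))
  have := R.swap.lie_h_wordSpan k hx
  rwa [neg_lie, neg_mem_iff] at this

theorem lie_f_triangular (R : ChevalleyRelations A e f h) (k : ι) {y : L}
    (hy : y ∈ wordSpan f ⊔ Submodule.span ℂ (Set.range h) ⊔ wordSpan e) :
    ⁅f k, y⁆ ∈ wordSpan f ⊔ Submodule.span ℂ (Set.range h) ⊔ wordSpan e := by
  have hc : ∀ p q r : Submodule ℂ L, p ⊔ q ⊔ r = r ⊔ q ⊔ p := fun p q r => by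
    rw [sup_assoc, sup_comm, sup_comm q r]
  rw [hc] at hy ⊢
  rw [← span_range_neg] at hy ⊢
  exact R.swap.lie_e_triangular k hy

end ChevalleyRelations

end Words

section Structure

variable {ι : Type*} [DecidableEq ι] (A : Matrix ι ι ℤ)

theorem chevalleyRelations : ChevalleyRelations A (e A) (f A) (h A) :=
  ⟨lie_h_h A, lie_e_f A, lie_h_e A, lie_h_f A⟩

/-- A Lie subalgebra that contains the Chevalley generators is everything. -/
theorem mem_of_generators_mem (K : LieSubalgebra ℂ (KM A)) (he : ∀ i, e A i ∈ K)
    (hf : ∀ i, f A i ∈ K) (hh : ∀ i, h A i ∈ K) (x : KM A) : x ∈ K := by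
  let π : FreeLieAlgebra ℂ (CartanMatrix.Generators ι) →ₗ⁅ℂ⁆ KM A :=
    { proj A with map_lie' := fun {x y} => proj_lie A x y }
  let g : CartanMatrix.Generators ι → K := fun
    | .E i => ⟨e A i, he i⟩
    | .F i => ⟨f A i, hf i⟩
    | .H i => ⟨h A i, hh i⟩
  have hπ : K.incl.comp (FreeLieAlgebra.lift ℂ g) = π := by
    refine FreeLieAlgebra.hom_ext fun y => ?_
    rw [LieHom.comp_apply, FreeLieAlgebra.lift_of_apply]
    cases y <;> rfl
  obtain ⟨y, rfl⟩ := Submodule.mkQ_surjective _ x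
  have : K.incl (FreeLieAlgebra.lift ℂ g y) = π y := by rw [← hπ, LieHom.comp_apply]
  exact (show π y ∈ K from this ▸ (FreeLieAlgebra.lift ℂ g y).2)

/-- The elements that map a subspace to itself form a Lie subalgebra. -/
def stabilizer {L : Type*} [LieRing L] [LieAlgebra ℂ L] (p : Submodule ℂ L) :
    LieSubalgebra ℂ L where
  carrier := {x | ∀ y ∈ p, ⁅x, y⁆ ∈ p}
  add_mem' {x x'} hx hx' y hy := by rw [add_lie]; exact add_mem (hx y hy) (hx' y hy)
  zero_mem' y _ := by rw [zero_lie]; exact p.zero_mem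
  smul_mem' c x hx y hy := by rw [smul_lie]; exact p.smul_mem c (hx y hy)
  lie_mem' {x x'} hx hx' y hy := by
    rw [lie_lie]
    exact sub_mem (hx _ (hx' y hy)) (hx' _ (hx y hy))

/-- The triangular decomposition `𝔤 = 𝔫₋ + 𝔥 + 𝔫₊`. -/
theorem triangular_eq_top :
    wordSpan (f A) ⊔ Submodule.span ℂ (Set.range (h A)) ⊔ wordSpan (e A) = ⊤ := by
  have R := chevalleyRelations A
  set T := wordSpan (f A) ⊔ Submodule.span ℂ (Set.range (h A)) ⊔ wordSpan (e A) with hT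
  have hstab := mem_of_generators_mem A (stabilizer T) (fun i y hy => R.lie_e_triangular i hy)
    (fun i y hy => R.lie_f_triangular i hy) (fun i y hy => R.lie_h_triangular i hy)
  let K : LieSubalgebra ℂ (KM A) := { T with lie_mem' := fun {x y} _ hy => hstab x y hy }
  refine eq_top_iff.2 fun x _ => mem_of_generators_mem A K (fun i => ?_) (fun i => ?_)
    (fun i => ?_) x
  · exact Submodule.mem_sup_right (word_mem_wordSpan (e A) i [])
  · exact Submodule.mem_sup_left (Submodule.mem_sup_left (word_mem_wordSpan (f A) i []))
  · exact Submodule.mem_sup_left (Submodule.mem_sup_right (Submodule.subset_span ⟨i, rfl⟩))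

/-! ### Root spaces -/

/-- The index set of the spanning family of `𝔤` that consists of the words in the `f i`, the words
in the `e i`, and the `h i`. -/
abbrev BasisIndex (ι : Type*) : Type _ := ((ι × List ι) ⊕ (ι × List ι)) ⊕ ι

/-- The spanning family of `𝔤` by words in the `f i`, words in the `e i`, and the `h i`. -/
noncomputable def basisVector : BasisIndex ι → KM A
  | .inl (.inl p) => word (f A) p.1 p.2
  | .inl (.inr p) => word (e A) p.1 p.2
  | .inr i => h A i

/-- The degree of the members of the spanning family in the root lattice. -/
def degree : BasisIndex ι → ι → ℤ
  | .inl (.inl p) => fun j => -((p.1 :: p.2).count j : ℤ)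
  | .inl (.inr p) => fun j => ((p.1 :: p.2).count j : ℤ)
  | .inr _ => 0

theorem degree_inl_ne_zero (p : (ι × List ι) ⊕ (ι × List ι)) : degree (.inl p) ≠ 0 := by
  intro h0
  rcases p with p | p
  · have := congrFun h0 p.1
    simp [degree] at this
    omega
  · have := congrFun h0 p.1
    simp [degree] at this
    omega

theorem span_basisVector : Submodule.span ℂ (Set.range (basisVector A)) = ⊤ := by
  refine top_le_iff.1 ((triangular_eq_top A).symm.trans_le (sup_le (sup_le ?_ ?_) ?_)) <;>
    refine Submodule.span_mono ?_ <;> rintro _ ⟨p, rfl⟩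
  · exact ⟨.inl (.inl p), rfl⟩
  · exact ⟨.inr p, rfl⟩
  · exact ⟨.inl (.inr p), rfl⟩

theorem lie_mem_rootSpace {l m : ι → ℂ} {x y : KM A} (hx : x ∈ rootSpace A l)
    (hy : y ∈ rootSpace A m) : ⁅x, y⁆ ∈ rootSpace A (l + m) := fun i => by
  rw [leibniz_lie, hx i, hy i, smul_lie, lie_smul, ← add_smul, Pi.add_apply]

theorem iSupIndep_rootSpace : iSupIndep (rootSpace A) := by
  refine (iSupIndep_iff_finsetSum_eq_zero_imp_eq_zero _).2 fun S z hz hsum l hl => ?_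
  exact (Submodule.mem_bot ℂ).1 (mem_of_sum_eigenvectors_mem
    (fun i => (LieAlgebra.ad ℂ (KM A) (h A i) : Module.End ℂ (KM A))) ⊥
    (fun i x hx => by rw [(Submodule.mem_bot ℂ).1 hx, map_zero]; exact zero_mem _)
    S z (fun l hl i => hz l hl i) ((Submodule.mem_bot ℂ).2 hsum) l hl)

variable [Fintype ι]

theorem list_sum_eq_mulVec_count (l : List ι) (k : ι) :
    (l.map (A k)).sum = (A.mulVec (fun j => (l.count j : ℤ))) k := by
  induction l with
  | nil => simp [Matrix.mulVec, dotProduct]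
  | cons j l ih =>
    rw [List.map_cons, List.sum_cons, ih]
    simp [Matrix.mulVec, dotProduct, List.count_cons, mul_add, Finset.sum_add_distrib, add_comm]

theorem basisVector_mem_rootSpace (p : BasisIndex ι) :
    basisVector A p ∈ rootSpace A (zWeight A (degree p)) := by
  have R := chevalleyRelations A
  rcases p with (p | p) | i <;> intro k
  · have h1 := R.swap.lie_h_word k p.1 p.2
    rw [neg_lie, list_sum_eq_mulVec_count, neg_eq_iff_eq_neg] at h1
    change ⁅h A k, word (f A) p.1 p.2⁆ = _ • word (f A) p.1 p.2
    rw [h1, ← neg_smul, zWeight_apply, Int.cast_smul_eq_zsmul]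
    congr 1
    rw [← Pi.neg_apply, ← Matrix.mulVec_neg]
    rfl
  · have h1 := R.lie_h_word k p.1 p.2
    rw [list_sum_eq_mulVec_count] at h1
    change ⁅h A k, word (e A) p.1 p.2⁆ = _ • word (e A) p.1 p.2
    rw [h1, zWeight_apply, Int.cast_smul_eq_zsmul]
    rfl
  · change ⁅h A k, h A i⁆ = _
    rw [lie_h_h]
    simp [degree]

/-- A root space is spanned by the members of the spanning family that have the right weight. -/
theorem rootSpace_eq_span (l : ι → ℂ) : rootSpace A l =
    Submodule.span ℂ (basisVector A '' {p | zWeight A (degree p) = l}) := by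
  set G : (ι → ℂ) → Submodule ℂ (KM A) := fun l =>
    Submodule.span ℂ (basisVector A '' {p | zWeight A (degree p) = l}) with hG
  have hle : ∀ l, G l ≤ rootSpace A l := fun l => by
    refine Submodule.span_le.2 ?_
    rintro _ ⟨p, rfl, rfl⟩
    exact basisVector_mem_rootSpace A p
  have hsup : G l ⊔ ⨆ (m) (_ : m ≠ l), G m = ⊤ := by
    refine top_le_iff.1 ((span_basisVector A).symm.trans_le (Submodule.span_le.2 ?_))
    rintro _ ⟨p, rfl⟩
    have hp : basisVector A p ∈ G (zWeight A (degree p)) := Submodule.subset_span ⟨p, rfl, rfl⟩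
    by_cases hpl : zWeight A (degree p) = l
    · exact Submodule.mem_sup_left (hpl ▸ hp)
    · exact Submodule.mem_sup_right
        (Submodule.mem_iSup_of_mem _ (Submodule.mem_iSup_of_mem hpl hp))
  have hdisj : (⨆ (m) (_ : m ≠ l), G m) ⊓ rootSpace A l = ⊥ :=
    ((iSupIndep_rootSpace A l).symm.mono_left (iSup₂_mono fun m _ => hle m)).eq_bot
  rw [← top_inf_eq (rootSpace A l), ← hsup, sup_inf_assoc_of_le _ (hle l), hdisj, sup_bot_eq]

theorem iSup_rootSpace : ⨆ l, rootSpace A l = ⊤ := by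
  refine top_le_iff.1 ((span_basisVector A).symm.trans_le (Submodule.span_le.2 ?_))
  rintro _ ⟨p, rfl⟩
  exact Submodule.mem_iSup_of_mem _ (basisVector_mem_rootSpace A p)

/-- A weight is the degree of a word. -/
theorem exists_degree_of_rootSpace_ne_bot {l : ι → ℂ} (hl : rootSpace A l ≠ ⊥) :
    ∃ p : BasisIndex ι, zWeight A (degree p) = l ∧ basisVector A p ≠ 0 := by
  by_contra! hne
  refine hl ((rootSpace_eq_span A l).trans (Submodule.span_eq_bot.2 ?_))
  rintro _ ⟨p, hp, rfl⟩
  exact hne p hp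

variable {A}

theorem finiteDimensional_rootSpace (hinj : Function.Injective (zWeight A)) (l : ι → ℂ) :
    FiniteDimensional ℂ (rootSpace A l) := by
  rw [rootSpace_eq_span]
  refine FiniteDimensional.span_of_finite ℂ (Set.Finite.image _ ?_)
  by_cases hne : ∃ b, zWeight A b = l
  swap
  · convert Set.finite_empty
    ext p
    simpa using fun hp => hne ⟨_, hp⟩
  obtain ⟨b, rfl⟩ := hne
  -- Words of a given degree have a given length.
  have hlen : ∀ w : List ι, (w.length : ℤ) = ∑ j, (w.count j : ℤ) := fun w => by
    rw [← Nat.cast_sum]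
    exact congrArg Nat.cast (show w.length = ∑ j, w.count j by
      simpa using (Multiset.sum_count_eq_card (s := Finset.univ) (m := (w : Multiset ι))
        (fun _ _ => Finset.mem_univ _)).symm)
  set N := (∑ j, b j).natAbs
  have hW : {w : ι × List ι | w.2.length ≤ N}.Finite := by
    have : {w : ι × List ι | w.2.length ≤ N} = Set.univ ×ˢ {w : List ι | w.length ≤ N} := by
      ext; simp
    rw [this]
    exact Set.finite_univ.prod (List.finite_length_le ι N)
  refine (((hW.image Sum.inl).union (hW.image Sum.inr)).image Sum.inl |>.union
    (Set.finite_range (Sum.inr : ι → BasisIndex ι))).subset ?_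
  intro p hp
  have hp' : degree p = b := hinj hp
  rcases p with (p | p) | i
  · refine Or.inl ⟨_, Or.inl ⟨p, ?_, rfl⟩, rfl⟩
    have h1 := hlen (p.1 :: p.2)
    have h2 : ∑ j, b j = -∑ j, ((p.1 :: p.2).count j : ℤ) := by
      rw [← hp', ← Finset.sum_neg_distrib]; rfl
    rw [List.length_cons] at h1
    change p.2.length ≤ (∑ j, b j).natAbs
    omega
  · refine Or.inl ⟨_, Or.inr ⟨p, ?_, rfl⟩, rfl⟩
    have h1 := hlen (p.1 :: p.2)
    have h2 : ∑ j, b j = ∑ j, ((p.1 :: p.2).count j : ℤ) := by rw [← hp']; rfl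
    rw [List.length_cons] at h1
    change p.2.length ≤ (∑ j, b j).natAbs
    omega
  · exact Or.inr ⟨i, rfl⟩

/-- The zero weight space is the Cartan subalgebra. -/
theorem rootSpace_zero_le (hinj : Function.Injective (zWeight A)) :
    rootSpace A 0 ≤ Submodule.span ℂ (Set.range (h A)) := by
  rw [rootSpace_eq_span]
  refine Submodule.span_mono ?_
  rintro _ ⟨p, hp, rfl⟩
  have hp' : degree p = 0 := hinj (hp.trans (map_zero _).symm)
  rcases p with p | i
  · exact absurd hp' (degree_inl_ne_zero p)
  · exact ⟨i, rfl⟩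

end Structure

/-! ### Real and imaginary roots -/

section Roots

variable {ι : Type*} [DecidableEq ι] (A : Matrix ι ι ℤ)

theorem omega_omega (x : KM A) : omega A (omega A x) = x := by
  let K : LieSubalgebra ℂ (KM A) :=
    { carrier := {x | omega A (omega A x) = x}
      add_mem' := fun {x y} hx hy => by
        simp only [Set.mem_ofPred_eq, map_add] at hx hy ⊢
        rw [hx, hy]
      zero_mem' := by simp
      smul_mem' := fun c x hx => by
        simp only [Set.mem_ofPred_eq, LinearMap.map_smulₛₗ, Complex.conj_conj] at hx ⊢
        rw [hx]
      lie_mem' := fun {x y} hx hy => by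
        change omega A (omega A ⁅x, y⁆) = _
        rw [omega_lie, omega_lie, hx, hy] }
  refine mem_of_generators_mem A K (fun i => ?_) (fun i => ?_) (fun i => ?_) x
  · change omega A (omega A (e A i)) = _
    rw [omega_e, map_neg, omega_f, neg_neg]
  · change omega A (omega A (f A i)) = _
    rw [omega_f, map_neg, omega_e, neg_neg]
  · change omega A (omega A (h A i)) = _
    rw [omega_h, map_neg, omega_h, neg_neg]

theorem omega_lowering (x : KM A) : omega A (lowering A x) = -x := by
  rw [lowering, map_neg, omega_omega]

theorem omega_mem_rootSpace {l : ι → ℂ} {x : KM A} (hx : x ∈ rootSpace A l) :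
    omega A x ∈ rootSpace A (-star l) := fun i => by
  have h1 := congrArg (omega A) (hx i)
  rw [omega_lie, omega_h, neg_lie, LinearMap.map_smulₛₗ] at h1
  rw [neg_eq_iff_eq_neg.1 h1, ← neg_smul]
  rfl

/-- The Serre relations make `ad (e i)` locally nilpotent. -/
theorem exists_ad_e_pow_eq_zero (i : ι) (x : KM A) :
    ∃ k : ℕ, (LieAlgebra.ad ℂ (KM A) (e A i) ^ k) x = 0 := by
  have R := chevalleyRelations A
  have heh : ∀ j, ⁅e A i, h A j⁆ = -(A j i • e A i) := fun j => by rw [← lie_skew, R.lie_h_e]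
  rw [← LieSubalgebra.mem_engel_iff]
  refine mem_of_generators_mem A _ (fun j => ?_) (fun j => ?_) (fun j => ?_) x <;>
    rw [LieSubalgebra.mem_engel_iff]
  · refine ⟨(-A i j).toNat + 1, ?_⟩
    rw [pow_succ, Module.End.mul_apply, LieAlgebra.ad_apply]
    exact ad_e_pow A i j
  · refine ⟨3, ?_⟩
    simp only [pow_succ, pow_zero, one_mul, Module.End.mul_apply, LieAlgebra.ad_apply, R.lie_e_f]
    split_ifs <;> simp [heh]
  · refine ⟨2, ?_⟩
    simp only [pow_succ, pow_zero, one_mul, Module.End.mul_apply, LieAlgebra.ad_apply, heh]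
    simp

/-- Words of length at least two in a single letter vanish. -/
theorem word_eq_zero_of_forall_eq (i : ι) (w : List ι) (hw : ∀ j ∈ w, j = i) (hw0 : w ≠ []) :
    word (e A) i w = 0 := by
  induction w with
  | nil => exact absurd rfl hw0
  | cons j w ih =>
    obtain rfl := hw j List.mem_cons_self
    change ⁅e A j, word (e A) j w⁆ = 0
    by_cases h0 : w = []
    · subst h0
      exact lie_self _
    · rw [ih (fun k hk => hw k (List.mem_cons_of_mem _ hk)) h0, lie_zero]

theorem degree_nonneg_or_nonpos (p : BasisIndex ι) :
    (∀ j, 0 ≤ degree p j) ∨ ∀ j, degree p j ≤ 0 := by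
  rcases p with (p | p) | i
  · exact Or.inr fun j => by simp [degree]
  · exact Or.inl fun j => by simp [degree]
  · exact Or.inl fun j => le_rfl

variable [Fintype ι] {A}

theorem f_mem_rootSpace (i : ι) : f A i ∈ rootSpace A (zWeight A (-Pi.single i 1)) := fun k => by
  rw [lie_h_f, zWeight_apply, Int.cast_smul_eq_zsmul, Matrix.mulVec_neg, Matrix.mulVec_single_one,
    Pi.neg_apply, neg_smul]
  rfl

theorem ad_f_pow_mem_rootSpace (i : ι) {b : ι → ℤ} {x : KM A}
    (hx : x ∈ rootSpace A (zWeight A b)) (k : ℕ) :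
    (LieAlgebra.ad ℂ (KM A) (f A i) ^ k) x ∈ rootSpace A (zWeight A (b - Pi.single i (k : ℤ))) := by
  induction k with
  | zero => simpa using hx
  | succ k ih =>
    rw [pow_succ', Module.End.mul_apply, LieAlgebra.ad_apply]
    have h1 := lie_mem_rootSpace A (f_mem_rootSpace i) ih
    rw [← map_add] at h1
    convert h1 using 2
    rw [Nat.cast_succ, Pi.single_add]
    congr 1
    abel

theorem ad_f_pow_ne_zero (hdiag : ∀ i, A i i = 2) (i : ι) {b : ι → ℤ} {x : KM A}
    (hx : x ∈ rootSpace A (zWeight A b)) (hx0 : x ≠ 0) (m : ℕ) (hm : A.mulVec b i = m) :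
    (LieAlgebra.ad ℂ (KM A) (f A i) ^ m) x ≠ 0 := by
  intro h0
  have R := chevalleyRelations A
  obtain ⟨r, hr⟩ := exists_ad_e_pow_eq_zero A i x
  refine hx0 (eq_zero_of_pow_lowering_eq_zero (X := LieAlgebra.ad ℂ (KM A) (e A i))
    (Y := LieAlgebra.ad ℂ (KM A) (f A i)) (H := LieAlgebra.ad ℂ (KM A) (h A i))
    (fun v => ?_) (fun v => ?_) (fun v => ?_) r x m hr ?_ h0)
  · simp only [LieAlgebra.ad_apply]
    rw [leibniz_lie (e A i), R.lie_e_f, if_pos rfl, add_comm]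
  · simp only [LieAlgebra.ad_apply]
    rw [leibniz_lie (h A i), R.lie_h_f, hdiag, neg_lie, smul_lie, sub_eq_neg_add,
      ← Int.cast_smul_eq_zsmul ℂ]
    simp
  · simp only [LieAlgebra.ad_apply]
    rw [leibniz_lie (h A i), R.lie_h_e, hdiag, smul_lie, add_comm, ← Int.cast_smul_eq_zsmul ℂ]
    simp
  · rw [LieAlgebra.ad_apply, hx i, zWeight_apply, hm]
    simp

theorem exists_degree_eq (hinj : Function.Injective (zWeight A)) {b : ι → ℤ}
    (hb : rootSpace A (zWeight A b) ≠ ⊥) :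
    ∃ p : BasisIndex ι, degree p = b ∧ basisVector A p ≠ 0 := by
  obtain ⟨p, hp, hp0⟩ := exists_degree_of_rootSpace_ne_bot A hb
  exact ⟨p, hinj hp, hp0⟩

/-- Among the positive multiples of a simple root only the simple root itself is a root. -/
theorem eq_one_of_rootSpace_single_ne_bot (hinj : Function.Injective (zWeight A)) {i : ι} {c : ℤ}
    (hc : 0 < c) (hb : rootSpace A (zWeight A (Pi.single i c)) ≠ ⊥) : c = 1 := by
  obtain ⟨p, hp, hp0⟩ := exists_degree_eq hinj hb
  have hpi : 0 < degree p i := by rw [hp]; simpa using hc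
  rcases p with (⟨k, w⟩ | ⟨k, w⟩) | k
  · simp [degree] at hpi
    omega
  · have hall : ∀ j ∈ k :: w, j = i := by
      intro j hj
      by_contra hne
      have h1 := congrFun hp j
      rw [Pi.single_eq_of_ne hne] at h1
      have h2 : 0 < (k :: w).count j := List.count_pos_iff.2 hj
      simp only [degree] at h1
      omega
    obtain rfl := hall k List.mem_cons_self
    by_cases hw : w = []
    · subst hw
      have h1 := congrFun hp k
      simpa [degree] using h1.symm
    · exact absurd (word_eq_zero_of_forall_eq A k w
        (fun j hj => hall j (List.mem_cons_of_mem _ hj)) hw) hp0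
  · simp [degree] at hpi

theorem latticeForm_single (b : ι → ℤ) (i : ι) (c : ℤ) :
    latticeForm A (Pi.single i c) b = c * A.mulVec b i := by
  simp [latticeForm]

theorem latticeForm_sub_single (hA : IsHyperbolic A) (b : ι → ℤ) (i : ι) (c : ℤ) :
    latticeForm A (b - Pi.single i c) (b - Pi.single i c) =
      latticeForm A b b - 2 * c * A.mulVec b i + 2 * c ^ 2 := by
  have h1 := latticeForm_single (A := A) b i c
  have h2 := latticeForm_symm A hA.symm b (Pi.single i c)
  have h3 := latticeForm_single (A := A) (Pi.single i c) i c
  have h4 : A.mulVec (Pi.single i c) i = 2 * c := by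
    rw [Matrix.mulVec_single, ← hA.diag i]
    simp [mul_comm]
  rw [h4] at h3
  rw [h1] at h2
  simp only [latticeForm, Matrix.mulVec_sub, dotProduct_sub, sub_dotProduct] at h1 h2 h3 ⊢
  rw [h1, h2, h3]
  ring

/-- Every positive root has norm at most two. By the simple reflections a positive root of positive
product with some simple root `α_i` that occurs in it is `α_i` or is moved to a positive root of
smaller height and the same norm; if there is no such `α_i`, then the norm is not positive. -/
theorem latticeForm_self_le_two_of_nonneg (hA : IsHyperbolic A)
    (hinj : Function.Injective (zWeight A)) (N : ℕ) (b : ι → ℤ) (hb : ∀ j, 0 ≤ b j)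
    (hN : ∑ j, b j = N) (hroot : rootSpace A (zWeight A b) ≠ ⊥) : latticeForm A b b ≤ 2 := by
  induction N using Nat.strong_induction_on generalizing b with
  | _ N ih =>
    by_cases hneg : ∀ i, b i * A.mulVec b i ≤ 0
    · exact (Finset.sum_nonpos fun i _ => hneg i).trans zero_le_two
    push Not at hneg
    obtain ⟨i, hi⟩ := hneg
    have hbi : 0 < b i := (hb i).lt_of_ne fun h0 => by simp [← h0] at hi
    have hm : 0 < A.mulVec b i := (mul_pos_iff_of_pos_left hbi).1 hi
    by_cases hj : ∃ j, j ≠ i ∧ 0 < b j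
    · obtain ⟨j, hji, hbj⟩ := hj
      obtain ⟨m, hm'⟩ := Int.eq_ofNat_of_zero_le hm.le
      obtain ⟨x, hx, hx0⟩ := Submodule.exists_mem_ne_zero_of_ne_bot hroot
      have hroot' : rootSpace A (zWeight A (b - Pi.single i (m : ℤ))) ≠ ⊥ :=
        (Submodule.ne_bot_iff _).2 ⟨_, ad_f_pow_mem_rootSpace i hx m,
          ad_f_pow_ne_zero hA.diag i hx hx0 m hm'⟩
      -- The reflected root keeps its positive coordinate at `j`, hence is again a positive root.
      have hb' : ∀ k, 0 ≤ (b - Pi.single i (m : ℤ) : ι → ℤ) k := by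
        obtain ⟨p, hp, -⟩ := exists_degree_eq hinj hroot'
        rw [← hp]
        refine (degree_nonneg_or_nonpos p).resolve_right fun hle => ?_
        have := hle j
        rw [hp, Pi.sub_apply, Pi.single_eq_of_ne hji] at this
        omega
      have hsum : ∑ k, (b - Pi.single i (m : ℤ) : ι → ℤ) k = N - m := by
        simp [Finset.sum_sub_distrib, hN]
      have hmN : m ≤ N := by
        have := Finset.sum_nonneg fun k (_ : k ∈ Finset.univ) => hb' k
        omega
      have h1 := ih (N - m) (by omega) _ hb' (by rw [hsum]; omega) hroot'
      rw [latticeForm_sub_single hA, hm'] at h1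
      linarith
    · have hbs : b = Pi.single i (b i) := by
        ext j
        by_cases hji : j = i
        · subst hji; simp
        · rw [Pi.single_eq_of_ne hji]
          exact le_antisymm (not_lt.1 fun h => hj ⟨j, hji, h⟩) (hb j)
      have h1 : b i = 1 := eq_one_of_rootSpace_single_ne_bot hinj hbi (hbs ▸ hroot)
      rw [hbs, latticeForm_single, h1, Matrix.mulVec_single_one, Matrix.col_apply, hA.diag]
      norm_num

/-- Every root, and zero, is an element of the root lattice of norm at most two. -/
theorem exists_zWeight_eq_of_rootSpace_ne_bot (hA : IsHyperbolic A)
    (hinj : Function.Injective (zWeight A)) {l : ι → ℂ} (hl : rootSpace A l ≠ ⊥) :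
    ∃ b, zWeight A b = l ∧ latticeForm A b b ≤ 2 := by
  obtain ⟨p, rfl, -⟩ := exists_degree_of_rootSpace_ne_bot A hl
  refine ⟨_, rfl, ?_⟩
  rcases degree_nonneg_or_nonpos p with hp | hp
  · exact latticeForm_self_le_two_of_nonneg hA hinj (∑ j, degree p j).toNat _ hp
      (Int.toNat_of_nonneg (Finset.sum_nonneg fun j _ => hp j)).symm hl
  · have hp' : ∀ j, 0 ≤ (-degree p) j := fun j => neg_nonneg.2 (hp j)
    have hl' : rootSpace A (zWeight A (-degree p)) ≠ ⊥ := by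
      obtain ⟨x, hx, hx0⟩ := Submodule.exists_mem_ne_zero_of_ne_bot hl
      refine (Submodule.ne_bot_iff _).2 ⟨omega A x, ?_, fun h0 => hx0 ?_⟩
      · convert omega_mem_rootSpace A hx using 2
        ext i
        simp [zWeight_apply, Matrix.mulVec_neg]
      · rw [← omega_omega A x, h0, map_zero]
    have h1 := latticeForm_self_le_two_of_nonneg hA hinj (∑ j, (-degree p) j).toNat _ hp'
      (Int.toNat_of_nonneg (Finset.sum_nonneg fun j _ => hp' j)).symm hl'
    simpa [latticeForm, Matrix.mulVec_neg] using h1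

end Roots

/-! ### Principal series modules -/

section PrincipalSeries

variable {M : Type*} [AddCommGroup M] [Module ℂ M]

/-- Operators `X`, `Y`, `H` with the commutation relations of `so(2,1)`, and a subspace `V` that is
irreducible under them, on which the Casimir operator is a scalar and on which the real spectrum of
`H` is unbounded in both directions. -/
structure IsPrincipal (X Y H : Module.End ℂ M) (V : Submodule ℂ M) : Prop where
  X_Y : ∀ v, X (Y v) = Y (X v) - H v
  H_X : ∀ v, H (X v) = X (H v) + X v
  H_Y : ∀ v, H (Y v) = Y (H v) - Y v
  X_mem : ∀ v ∈ V, X v ∈ V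
  Y_mem : ∀ v ∈ V, Y v ∈ V
  irreducible : ∀ W ≤ V, (∀ v ∈ W, X v ∈ W) → (∀ v ∈ W, Y v ∈ W) → (∀ v ∈ W, H v ∈ W) →
    W = ⊥ ∨ W = V
  casimir : ∃ c : ℂ, ∀ v ∈ V, H (H v) - X (Y v) - Y (X v) = c • v
  unbounded_above : ∀ R : ℝ, ∃ t : ℝ, R < t ∧ ∃ v ∈ V, v ≠ 0 ∧ H v = (t : ℂ) • v
  unbounded_below : ∀ R : ℝ, ∃ t : ℝ, t < R ∧ ∃ v ∈ V, v ≠ 0 ∧ H v = (t : ℂ) • v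

/-- An irreducible subspace is spanned by any family of eigenvectors of `H` in it whose span is
stable under `X` and `Y`. -/
theorem eq_span_of_eigenvectors {X Y H : Module.End ℂ M} {V : Submodule ℂ M}
    (hirr : ∀ W ≤ V, (∀ v ∈ W, X v ∈ W) → (∀ v ∈ W, Y v ∈ W) → (∀ v ∈ W, H v ∈ W) →
      W = ⊥ ∨ W = V) {σ : Type*} (v : σ → M) (t : σ → ℂ) (hV : ∀ k, v k ∈ V)
    (hH : ∀ k, H (v k) = t k • v k) (hX : ∀ k, X (v k) ∈ Submodule.span ℂ (Set.range v))
    (hY : ∀ k, Y (v k) ∈ Submodule.span ℂ (Set.range v)) (hne : ∃ k, v k ≠ 0) :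
    V = Submodule.span ℂ (Set.range v) := by
  have hstab : ∀ T : Module.End ℂ M, (∀ k, T (v k) ∈ Submodule.span ℂ (Set.range v)) →
      ∀ x ∈ Submodule.span ℂ (Set.range v), T x ∈ Submodule.span ℂ (Set.range v) := fun T hT =>
    show Submodule.span ℂ (Set.range v) ≤ (Submodule.span ℂ (Set.range v)).comap T from
      Submodule.span_le.2 (by rintro _ ⟨k, rfl⟩; exact hT k)
  obtain ⟨k, hk⟩ := hne
  refine ((hirr _ (Submodule.span_le.2 ?_) (hstab X hX) (hstab Y hY)
    (hstab H fun k => ?_)).resolve_left fun h0 => hk ?_).symm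
  · rintro _ ⟨k, rfl⟩
    exact hV k
  · rw [hH]
    exact Submodule.smul_mem _ _ (Submodule.subset_span ⟨k, rfl⟩)
  · exact (Submodule.mem_bot ℂ).1 (h0 ▸ Submodule.subset_span ⟨k, rfl⟩)

namespace IsPrincipal

variable {X Y H : Module.End ℂ M} {V : Submodule ℂ M}

theorem swap (P : IsPrincipal X Y H V) : IsPrincipal Y X (-H) V where
  X_Y v := by rw [P.X_Y, LinearMap.neg_apply]; abel
  H_X v := by simp only [LinearMap.neg_apply, P.H_Y, map_neg]; abel
  H_Y v := by simp only [LinearMap.neg_apply, P.H_X, map_neg]; abel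
  X_mem := P.Y_mem
  Y_mem := P.X_mem
  irreducible W hW hY hX hH := P.irreducible W hW hX hY fun v hv => by
    simpa using hH v hv
  casimir := by
    obtain ⟨c, hc⟩ := P.casimir
    refine ⟨c, fun v hv => ?_⟩
    rw [← hc v hv]
    simp only [LinearMap.neg_apply, map_neg, neg_neg]
    abel
  unbounded_above R := by
    obtain ⟨t, ht, v, hv, hv0, hvt⟩ := P.unbounded_below (-R)
    exact ⟨-t, by linarith, v, hv, hv0, by simp [hvt]⟩
  unbounded_below R := by
    obtain ⟨t, ht, v, hv, hv0, hvt⟩ := P.unbounded_above (-R)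
    exact ⟨-t, by linarith, v, hv, hv0, by simp [hvt]⟩

theorem Y_pow_mem (P : IsPrincipal X Y H V) {v : M} (hv : v ∈ V) (k : ℕ) : (Y ^ k) v ∈ V := by
  induction k with
  | zero => exact hv
  | succ k ih => rw [pow_succ', Module.End.mul_apply]; exact P.Y_mem _ ih

theorem X_pow_mem (P : IsPrincipal X Y H V) {v : M} (hv : v ∈ V) (k : ℕ) : (X ^ k) v ∈ V :=
  P.swap.Y_pow_mem hv k

theorem H_Y_pow (P : IsPrincipal X Y H V) {v : M} {t : ℂ} (hv : H v = t • v) (k : ℕ) :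
    H ((Y ^ k) v) = (t - k) • (Y ^ k) v := by
  induction k with
  | zero => simpa using hv
  | succ k ih =>
    rw [pow_succ', Module.End.mul_apply, P.H_Y, ih, map_smul, Nat.cast_succ, ← sub_sub,
      sub_smul _ (1 : ℂ), one_smul]

theorem H_X_pow (P : IsPrincipal X Y H V) {v : M} {t : ℂ} (hv : H v = t • v) (k : ℕ) :
    H ((X ^ k) v) = (t + k) • (X ^ k) v := by
  have h1 := P.swap.H_Y_pow (v := v) (t := -t) (by rw [LinearMap.neg_apply, hv, neg_smul]) k
  rw [LinearMap.neg_apply, neg_eq_iff_eq_neg, ← neg_smul] at h1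
  rw [h1]
  congr 1
  ring

/-- On an eigenspace of `H` in `V`, the Casimir operator determines `X Y`. -/
theorem exists_X_Y_eq_smul (P : IsPrincipal X Y H V) {v : M} (hV : v ∈ V) {t : ℂ}
    (hv : H v = t • v) : ∃ q : ℂ, X (Y v) = q • v := by
  obtain ⟨c, hc⟩ := P.casimir
  have h1 := hc v hV
  have h2 := P.X_Y v
  rw [hv] at h2
  rw [hv, map_smul, hv, eq_add_of_sub_eq h2.symm, smul_smul] at h1
  refine ⟨(t * t - t - c) / 2, ?_⟩
  have h3 : (2 : ℂ) • X (Y v) = (t * t - t - c) • v := by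
    rw [sub_smul, sub_smul, ← h1, two_smul]
    abel
  rw [div_eq_inv_mul, ← smul_smul, ← h3, smul_smul]
  norm_num

theorem exists_Y_X_eq_smul (P : IsPrincipal X Y H V) {v : M} (hV : v ∈ V) {t : ℂ}
    (hv : H v = t • v) : ∃ q : ℂ, Y (X v) = q • v :=
  P.swap.exists_X_Y_eq_smul hV (t := -t) (by rw [LinearMap.neg_apply, hv, neg_smul])

/-- A vector killed by `X` would generate a submodule with spectrum bounded from above. -/
theorem X_ne_zero (P : IsPrincipal X Y H V) {v : M} (hV : v ∈ V) (hv0 : v ≠ 0) {t : ℂ}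
    (hv : H v = t • v) : X v ≠ 0 := by
  intro hX
  have hspan := eq_span_of_eigenvectors P.irreducible (fun k : ℕ => (Y ^ k) v) (fun k => t - k)
    (P.Y_pow_mem hV) (P.H_Y_pow hv) (fun k => ?_) (fun k => ?_) ⟨0, hv0⟩
  · obtain ⟨s, hs, w, hw, hw0, hws⟩ := P.unbounded_above t.re
    obtain ⟨k, hk⟩ := exists_eigenvalue_eq_of_mem_span H _ _ (P.H_Y_pow hv) (hspan ▸ hw) hw0 hws
    have h1 := congrArg Complex.re hk
    simp only [Complex.ofReal_re, Complex.sub_re, Complex.natCast_re] at h1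
    have h2 : (0 : ℝ) ≤ k := k.cast_nonneg
    linarith
  · rcases k with _ | k
    · simp [hX]
    · obtain ⟨q, hq⟩ := P.exists_X_Y_eq_smul (P.Y_pow_mem hV k) (P.H_Y_pow hv k)
      rw [pow_succ', Module.End.mul_apply, hq]
      exact Submodule.smul_mem _ _ (Submodule.subset_span ⟨k, rfl⟩)
  · exact Submodule.subset_span ⟨k + 1, by simp [pow_succ']⟩

theorem Y_ne_zero (P : IsPrincipal X Y H V) {v : M} (hV : v ∈ V) (hv0 : v ≠ 0) {t : ℂ}
    (hv : H v = t • v) : Y v ≠ 0 :=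
  P.swap.X_ne_zero hV hv0 (t := -t) (by rw [LinearMap.neg_apply, hv, neg_smul])

theorem exists_Y_X_eq_smul_ne_zero (P : IsPrincipal X Y H V) {v : M} (hV : v ∈ V) (hv0 : v ≠ 0)
    {t : ℂ} (hv : H v = t • v) : ∃ q : ℂ, q ≠ 0 ∧ Y (X v) = q • v := by
  obtain ⟨q, hq⟩ := P.exists_Y_X_eq_smul hV hv
  refine ⟨q, ?_, hq⟩
  rintro rfl
  have h1 := P.H_X_pow hv 1
  rw [pow_one] at h1
  exact P.Y_ne_zero (P.X_mem v hV) (P.X_ne_zero hV hv0 hv) h1 (hq.trans (zero_smul ℂ v))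

/-- Every eigenvector of `H` in `V` generates `V` by its images under powers of `X` and of `Y`. -/
theorem eq_span_pow (P : IsPrincipal X Y H V) {v : M} (hV : v ∈ V) (hv0 : v ≠ 0) {t : ℂ}
    (hv : H v = t • v) : V = Submodule.span ℂ
      (Set.range (Sum.elim (fun k : ℕ => (X ^ k) v) (fun k : ℕ => (Y ^ k) v))) := by
  have hX : ∀ k : ℕ, (X ^ k) v ∈ Submodule.span ℂ
      (Set.range (Sum.elim (fun k : ℕ => (X ^ k) v) (fun k : ℕ => (Y ^ k) v))) :=
    fun k => Submodule.subset_span ⟨.inl k, rfl⟩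
  have hY : ∀ k : ℕ, (Y ^ k) v ∈ Submodule.span ℂ
      (Set.range (Sum.elim (fun k : ℕ => (X ^ k) v) (fun k : ℕ => (Y ^ k) v))) :=
    fun k => Submodule.subset_span ⟨.inr k, rfl⟩
  refine eq_span_of_eigenvectors P.irreducible _
    (Sum.elim (fun k : ℕ => t + k) (fun k : ℕ => t - k)) ?_ ?_ ?_ ?_ ⟨.inl 0, hv0⟩ <;>
    rintro (k | k) <;> simp only [Sum.elim_inl, Sum.elim_inr]
  · exact P.X_pow_mem hV k
  · exact P.Y_pow_mem hV k
  · exact P.H_X_pow hv k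
  · exact P.H_Y_pow hv k
  · rw [← Module.End.mul_apply, ← pow_succ']
    exact hX (k + 1)
  · rcases k with _ | k
    · simpa using hX 1
    · obtain ⟨q, hq⟩ := P.exists_X_Y_eq_smul (P.Y_pow_mem hV k) (P.H_Y_pow hv k)
      rw [pow_succ', Module.End.mul_apply, hq]
      exact Submodule.smul_mem _ _ (hY k)
  · rcases k with _ | k
    · simpa using hY 1
    · obtain ⟨q, hq⟩ := P.exists_Y_X_eq_smul (P.X_pow_mem hV k) (P.H_X_pow hv k)
      rw [pow_succ', Module.End.mul_apply, hq]
      exact Submodule.smul_mem _ _ (hX k)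
  · rw [← Module.End.mul_apply, ← pow_succ']
    exact hY (k + 1)

theorem exists_eigenvector (P : IsPrincipal X Y H V) :
    ∃ v ∈ V, v ≠ 0 ∧ ∃ t : ℝ, H v = (t : ℂ) • v := by
  obtain ⟨t, -, v, hv, hv0, hvt⟩ := P.unbounded_above 0
  exact ⟨v, hv, hv0, t, hvt⟩

/-- The spectrum of `H` meets the interval `[0, 1]`. -/
theorem exists_eigenvector_mem_Icc (P : IsPrincipal X Y H V) :
    ∃ t : ℝ, 0 ≤ t ∧ t ≤ 1 ∧ ∃ v ∈ V, v ≠ 0 ∧ H v = (t : ℂ) • v := by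
  obtain ⟨t, ht, v, hv, hv0, hvt⟩ := P.unbounded_above 0
  have hne : ∀ k : ℕ, (Y ^ k) v ≠ 0 := fun k => by
    induction k with
    | zero => exact hv0
    | succ k ih =>
      rw [pow_succ', Module.End.mul_apply]
      exact P.Y_ne_zero (P.Y_pow_mem hv k) ih (P.H_Y_pow hvt k)
  refine ⟨t - ⌊t⌋₊, ?_, ?_, _, P.Y_pow_mem hv ⌊t⌋₊, hne _, ?_⟩
  · linarith [Nat.floor_le ht.le]
  · linarith [Nat.lt_floor_add_one t]
  · rw [P.H_Y_pow hvt]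
    push_cast
    rfl

end IsPrincipal

end PrincipalSeries

/-! ### Weight components -/

section Component

variable {ι : Type*} [Fintype ι] [DecidableEq ι] (A : Matrix ι ι ℤ)

theorem isCompl_rootSpace (l : ι → ℂ) :
    IsCompl (rootSpace A l) (⨆ m : {m : ι → ℂ // m ≠ l}, rootSpace A m.1) := by
  refine ⟨?_, codisjoint_iff.2 (top_le_iff.1 ((iSup_rootSpace A).symm.trans_le
    (iSup_le fun m => ?_)))⟩
  · have h1 := iSupIndep_rootSpace A l
    rwa [iSup_subtype'] at h1
  · by_cases hm : m = l
    · exact hm ▸ le_sup_left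
    · exact le_sup_of_le_right
        (le_iSup (fun m : {m : ι → ℂ // m ≠ l} => rootSpace A m.1) ⟨m, hm⟩)

/-- The component of an element of `𝔤` in the eigenspace `𝔤_l`. -/
noncomputable def component (l : ι → ℂ) : KM A →ₗ[ℂ] KM A :=
  Submodule.projection _ _ (isCompl_rootSpace A l)

theorem component_mem (l : ι → ℂ) (x : KM A) : component A l x ∈ rootSpace A l :=
  Submodule.projection_apply_mem _ _

theorem component_of_mem {l : ι → ℂ} {x : KM A} (hx : x ∈ rootSpace A l) :
    component A l x = x :=
  Submodule.projection_apply_of_mem_left _ hx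

theorem component_of_mem_ne {l m : ι → ℂ} (hlm : m ≠ l) {x : KM A} (hx : x ∈ rootSpace A m) :
    component A l x = 0 :=
  (Submodule.projection_apply_eq_zero_iff _).2
    (Submodule.mem_iSup_of_mem (p := fun m : {m : ι → ℂ // m ≠ l} => rootSpace A m.1) ⟨m, hlm⟩ hx)

theorem mem_weightsOf_iff (V : Submodule ℂ (KM A)) (l : ι → ℂ) :
    l ∈ weightsOf A V ↔ ∃ x ∈ V, component A l x ≠ 0 := by
  rw [weightsOf, Set.mem_ofPred_eq, SetLike.not_le_iff_exists]
  simp only [component, ne_eq, Submodule.projection_apply_eq_zero_iff]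

theorem exists_eq_sum_component (x : KM A) :
    ∃ S : Finset (ι → ℂ), x = ∑ l ∈ S, component A l x := by
  classical
  suffices hS : ∃ S : Finset (ι → ℂ), ∀ T, S ⊆ T → x = ∑ l ∈ T, component A l x by
    obtain ⟨S, hS⟩ := hS
    exact ⟨S, hS S subset_rfl⟩
  have hx : x ∈ ⨆ l, rootSpace A l := by rw [iSup_rootSpace]; trivial
  induction hx using Submodule.iSup_induction' with
  | mem l x hx =>
    refine ⟨{l}, fun T hT => ?_⟩
    rw [Finset.sum_eq_single_of_mem l (hT (Finset.mem_singleton_self l))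
      fun m _ hm => component_of_mem_ne A hm.symm hx, component_of_mem A hx]
  | zero => exact ⟨∅, fun T _ => by simp⟩
  | add x y _ _ hx hy =>
    obtain ⟨S, hS⟩ := hx
    obtain ⟨S', hS'⟩ := hy
    refine ⟨S ∪ S', fun T hT => ?_⟩
    simp only [map_add, Finset.sum_add_distrib]
    rw [← hS T (Finset.union_subset_left hT), ← hS' T (Finset.union_subset_right hT)]

theorem component_lie {a : ι → ℂ} {y : KM A} (hy : y ∈ rootSpace A a) (l : ι → ℂ) (x : KM A) :
    component A (a + l) ⁅y, x⁆ = ⁅y, component A l x⁆ := by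
  have hx : x ∈ ⨆ l, rootSpace A l := by rw [iSup_rootSpace]; trivial
  induction hx using Submodule.iSup_induction' with
  | mem m x hx =>
    have hyx := lie_mem_rootSpace A hy hx
    by_cases hm : m = l
    · subst hm
      rw [component_of_mem A hyx, component_of_mem A hx]
    · rw [component_of_mem_ne A (fun h => hm (add_left_cancel h)) hyx,
        component_of_mem_ne A hm hx, lie_zero]
  | zero => simp
  | add x y _ _ hx hy => rw [lie_add, map_add, hx, hy, map_add, lie_add]

theorem rootSpace_ne_bot_of_mem_weightsOf {V : Submodule ℂ (KM A)} {l : ι → ℂ}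
    (hl : l ∈ weightsOf A V) : rootSpace A l ≠ ⊥ := by
  obtain ⟨x, -, hx⟩ := (mem_weightsOf_iff A V l).1 hl
  exact (Submodule.ne_bot_iff _).2 ⟨_, component_mem A l x, hx⟩

theorem weightsOf_nonempty {V : Submodule ℂ (KM A)} {x : KM A} (hx : x ∈ V) (hx0 : x ≠ 0) :
    (weightsOf A V).Nonempty := by
  obtain ⟨S, hS⟩ := exists_eq_sum_component A x
  obtain ⟨l, -, hl⟩ := Finset.exists_ne_zero_of_sum_ne_zero (hS ▸ hx0)
  exact ⟨l, (mem_weightsOf_iff A V l).2 ⟨x, hx, hl⟩⟩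

theorem mem_roots_union_zero {l : ι → ℂ} (hl : rootSpace A l ≠ ⊥) : l ∈ roots A ∪ {0} := by
  by_cases h0 : l = 0
  · exact Or.inr h0
  · exact Or.inl ⟨h0, hl⟩

/-- A subspace that is stable under `𝔥` contains the weight components of its elements. -/
theorem component_mem_of_stable {V : Submodule ℂ (KM A)} (hV : ∀ i, ∀ x ∈ V, ⁅h A i, x⁆ ∈ V)
    {x : KM A} (hx : x ∈ V) (l : ι → ℂ) : component A l x ∈ V := by
  obtain ⟨S, hS⟩ := exists_eq_sum_component A x
  by_cases hl : l ∈ S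
  · exact mem_of_sum_eigenvectors_mem
      (fun i => (LieAlgebra.ad ℂ (KM A) (h A i) : Module.End ℂ (KM A))) V hV S
      (fun l => component A l x) (fun l _ i => component_mem A l x i) (hS ▸ hx) l hl
  · have h0 : component A l x = 0 := by
      conv_lhs => rw [hS]
      rw [map_sum]
      exact Finset.sum_eq_zero fun m hm => component_of_mem_ne A
        (fun (hml : m = l) => hl (hml ▸ hm)) (component_mem A m x)
    exact h0 ▸ V.zero_mem

end Component

/-! ### The subalgebra attached to a timelike root vector -/

section So21

variable {ι : Type*} [Fintype ι] (A : Matrix ι ι ℤ) (n : ι → ℕ)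

theorem level_add (l m : ι → ℂ) : level A n (l + m) = level A n l + level A n m := by
  simp only [level, Pi.add_apply, mul_add, Finset.sum_add_distrib, add_div]

theorem level_neg (l : ι → ℂ) : level A n (-l) = -level A n l := by
  simp only [level, Pi.neg_apply, mul_neg, Finset.sum_neg_distrib, neg_div]

variable {n} in
theorem level_latticeWeight (hn : normSq A n ≠ 0) : level A n (latticeWeight A n) = 1 := by
  rw [latticeWeight_eq_zWeight, level_zWeight, ← normSq_eq_latticeForm]
  exact div_self (by exact_mod_cast hn)

theorem level_add_zsmul (hn : normSq A n ≠ 0) (l : ι → ℂ) (k : ℤ) :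
    level A n (l + k • latticeWeight A n) = level A n l + k := by
  have hk : level A n (k • latticeWeight A n) = k * level A n (latticeWeight A n) := by
    simp only [level, Pi.smul_apply, zsmul_eq_mul, ← mul_div_assoc, Finset.mul_sum]
    congr 1
    exact Finset.sum_congr rfl fun j _ => by ring
  rw [level_add, hk, level_latticeWeight A hn, mul_one]

theorem star_latticeWeight : star (latticeWeight A n) = latticeWeight A n := by
  ext i
  simp [latticeWeight]

variable {A n} in
/-- Translation by `α` shifts the level by one, so that every string meets every slab. -/
theorem exists_zsmul_mem_slab (hn : normSq A n ≠ 0) (β : ι → ℂ) (c : ℝ) :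
    ∃ k : ℤ, β + k • latticeWeight A n ∈ slab A n c := by
  refine ⟨⌈c - (level A n β).re⌉, ?_, ?_⟩ <;>
    rw [level_add_zsmul A n hn, Complex.add_re, Complex.intCast_re]
  · linarith [Int.le_ceil (c - (level A n β).re)]
  · linarith [Int.ceil_lt_add_one (c - (level A n β).re)]

variable [DecidableEq ι]

theorem J3_mem_rootSpace : J3 A n ∈ rootSpace A 0 := by
  refine Submodule.smul_mem _ _ (Submodule.sum_mem _ fun j _ => Submodule.smul_mem _ _ fun i => ?_)
  rw [lie_h_h, Pi.zero_apply, zero_smul]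

variable {A n}

theorem lie_coroot {l : ι → ℂ} {x : KM A} (hx : x ∈ rootSpace A l) :
    ⁅coroot A n, x⁆ = (∑ j, (n j : ℂ) * l j) • x := by
  rw [coroot, sum_lie, Finset.sum_smul]
  exact Finset.sum_congr rfl fun j _ => by rw [smul_lie, hx j, smul_smul]

theorem lie_J3 {l : ι → ℂ} {x : KM A} (hx : x ∈ rootSpace A l) :
    ⁅J3 A n, x⁆ = level A n l • x := by
  rw [J3, smul_lie, lie_coroot hx, smul_smul, level, div_eq_inv_mul]

variable {E : KM A}

theorem lowering_mem_rootSpace (hE : E ∈ rootSpace A (latticeWeight A n)) :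
    lowering A E ∈ rootSpace A (-latticeWeight A n) := by
  have h1 := omega_mem_rootSpace A hE
  rw [star_latticeWeight A n] at h1
  exact Submodule.neg_mem _ h1

theorem Jplus_mem_rootSpace (hE : E ∈ rootSpace A (latticeWeight A n)) :
    Jplus A n E ∈ rootSpace A (latticeWeight A n) :=
  Submodule.smul_mem _ _ hE

theorem Jminus_mem_rootSpace (hE : E ∈ rootSpace A (latticeWeight A n)) :
    Jminus A n E ∈ rootSpace A (-latticeWeight A n) :=
  Submodule.smul_mem _ _ (lowering_mem_rootSpace hE)

theorem lie_J3_Jplus (hn : normSq A n ≠ 0) (hE : E ∈ rootSpace A (latticeWeight A n)) :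
    ⁅J3 A n, Jplus A n E⁆ = Jplus A n E := by
  rw [lie_J3 (Jplus_mem_rootSpace hE), level_latticeWeight A hn, one_smul]

theorem lie_J3_Jminus (hn : normSq A n ≠ 0) (hE : E ∈ rootSpace A (latticeWeight A n)) :
    ⁅J3 A n, Jminus A n E⁆ = -Jminus A n E := by
  rw [lie_J3 (Jminus_mem_rootSpace hE), level_neg, level_latticeWeight A hn, neg_smul, one_smul]

/-- The Cartan matrix is non-degenerate over `ℂ` if it is so over `ℤ`. -/
theorem mulVec_eq_zero_imp (hinj : Function.Injective (zWeight A)) (c : ι → ℂ)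
    (hc : (A.map (Int.cast : ℤ → ℂ)).mulVec c = 0) : c = 0 := by
  have hdet : A.det ≠ 0 := fun h0 => by
    obtain ⟨v, hv, hv0⟩ := Matrix.exists_mulVec_eq_zero_iff.2 h0
    refine hv (hinj ?_)
    ext i
    simp [zWeight_apply, hv0]
  by_contra hne
  have h1 := Matrix.exists_mulVec_eq_zero_iff.1 ⟨c, hne, hc⟩
  rw [show A.map (Int.cast : ℤ → ℂ) = A.map (Int.castRingHom ℂ) from rfl,
    ← RingHom.mapMatrix_apply, ← RingHom.map_det] at h1
  exact hdet (by simpa using h1)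

/-- The invariance of the form makes `[x, y]` a multiple of `H(α)`, for `x` in the root space of
`α` and `y` in that of `-α`. -/
theorem IsStandardForm.lie_eq_smul_coroot {B : KM A →ₗ[ℂ] KM A →ₗ[ℂ] ℂ} (hB : IsStandardForm A B)
    (hinj : Function.Injective (zWeight A)) {x y : KM A}
    (hx : x ∈ rootSpace A (latticeWeight A n)) (hy : y ∈ rootSpace A (-latticeWeight A n)) :
    ⁅x, y⁆ = B x y • coroot A n := by
  have h0 : ⁅x, y⁆ ∈ rootSpace A 0 := by
    rw [← add_neg_cancel (latticeWeight A n)]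
    exact lie_mem_rootSpace A hx hy
  obtain ⟨c, hc⟩ := (Submodule.mem_span_range_iff_exists_fun ℂ).1 (rootSpace_zero_le hinj h0)
  suffices hcn : (fun j => c j - B x y * n j) = 0 by
    rw [← hc, coroot, Finset.smul_sum]
    refine Finset.sum_congr rfl fun j _ => ?_
    rw [smul_smul, ← sub_eq_zero.1 (congrFun hcn j)]
  refine mulVec_eq_zero_imp hinj _ (funext fun k => ?_)
  have h1 : B ⁅x, y⁆ (h A k) = latticeWeight A n k * B x y := by
    rw [hB.invariant, ← lie_skew, hy k, Pi.neg_apply, neg_smul, neg_neg, map_smul, smul_eq_mul]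
  have h2 : B ⁅x, y⁆ (h A k) = ∑ j, (A k j : ℂ) * c j := by
    rw [← hc, hB.symm, map_sum]
    exact Finset.sum_congr rfl fun j _ => by rw [map_smul, hB.h_h, smul_eq_mul, mul_comm]
  rw [h2, latticeWeight, Finset.sum_mul] at h1
  simp only [Matrix.mulVec, dotProduct, Matrix.map_apply, mul_sub, Finset.sum_sub_distrib, h1,
    Pi.zero_apply]
  rw [sub_eq_zero]
  exact Finset.sum_congr rfl fun j _ => by ring

theorem omega_coroot : omega A (coroot A n) = -coroot A n := by
  rw [coroot, map_sum, ← Finset.sum_neg_distrib]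
  refine Finset.sum_congr rfl fun j _ => ?_
  rw [LinearMap.map_smulₛₗ, omega_h, smul_neg, map_natCast]

theorem IsStandardForm.coroot_ne_zero {B : KM A →ₗ[ℂ] KM A →ₗ[ℂ] ℂ} (hB : IsStandardForm A B)
    (hn : normSq A n ≠ 0) : coroot A n ≠ 0 := by
  intro h0
  have h1 : B (coroot A n) (coroot A n) = (normSq A n : ℂ) := by
    simp only [coroot, map_sum, map_smul, LinearMap.sum_apply, LinearMap.smul_apply, hB.h_h,
      smul_eq_mul, normSq, Int.cast_sum, Int.cast_mul, Int.cast_natCast]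
    simp only [Finset.mul_sum]
    rw [Finset.sum_comm]
    exact Finset.sum_congr rfl fun i _ => Finset.sum_congr rfl fun j _ => by ring
  rw [h0, map_zero, eq_comm, Int.cast_eq_zero] at h1
  exact hn h1

/-- The relation `[E, F] = N H(α)`. That `⟨E | F⟩` is real follows by applying the antilinear
involution, which maps both sides to their negatives. -/
theorem lie_lowering (hB : IsStandardForm A (standardForm A))
    (hinj : Function.Injective (zWeight A)) (hn : normSq A n ≠ 0)
    (hE : E ∈ rootSpace A (latticeWeight A n)) :
    ⁅E, lowering A E⁆ = (pairing A E : ℂ) • coroot A n := by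
  have h1 := hB.lie_eq_smul_coroot hinj hE (lowering_mem_rootSpace hE)
  have h2 := congrArg (omega A) h1
  have h3 : omega A E = -lowering A E := (neg_neg _).symm
  rw [omega_lie, omega_lowering, h3, neg_lie, lie_neg, neg_neg, LinearMap.map_smulₛₗ, omega_coroot,
    ← lie_skew, h1, smul_neg, neg_inj] at h2
  have h4 := smul_left_injective ℂ (hB.coroot_ne_zero hn) h2
  rw [h1, pairing, Complex.conj_eq_iff_re.1 h4.symm]

/-- The relation `[J⁺, J⁻] = -J₃`. A non-zero normalization factor means that `N (-α²)` is positive,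
so that `standardForm A` is not zero and hence is a form with the defining properties. -/
theorem lie_Jplus_Jminus (hinj : Function.Injective (zWeight A)) (hn : normSq A n ≠ 0)
    (hE : E ∈ rootSpace A (latticeWeight A n)) (hs : scale A n E ≠ 0) :
    ⁅Jplus A n E, Jminus A n E⁆ = -J3 A n := by
  have hpos : 0 < -(pairing A E * (normSq A n : ℝ)) := by
    by_contra hle
    exact hs (by rw [scale, Real.sqrt_eq_zero_of_nonpos (not_lt.1 hle)]; simp)
  have hp : pairing A E ≠ 0 := fun h0 => by simp [h0] at hpos
  have hB : IsStandardForm A (standardForm A) := by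
    by_cases hex : ∃ B, IsStandardForm A B
    · rw [standardForm, dif_pos hex]
      exact hex.choose_spec
    · exact absurd (by rw [pairing, standardForm, dif_neg hex]; simp) hp
  -- The square of the normalization factor is `1 / (-N α²)`.
  have hscale : scale A n E * scale A n E * (pairing A E : ℂ) = -((normSq A n : ℂ))⁻¹ := by
    rw [scale, ← Complex.ofReal_mul, ← mul_inv, Real.mul_self_sqrt hpos.le]
    have hn' : (normSq A n : ℂ) ≠ 0 := by exact_mod_cast hn
    have hp' : (pairing A E : ℂ) ≠ 0 := by exact_mod_cast hp
    push_cast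
    field_simp
  rw [Jplus, Jminus, smul_lie, lie_smul, lie_lowering hB hinj hn hE, smul_smul, smul_smul, hscale,
    J3, neg_smul]

/-- A subspace that is stable under `J₃`, `J⁺`, `J⁻` is stable under `so(2,1)_α`. -/
theorem lie_mem_of_mem_so21 {W : Submodule ℂ (KM A)} (h3 : ∀ v ∈ W, ⁅J3 A n, v⁆ ∈ W)
    (hp : ∀ v ∈ W, ⁅Jplus A n E, v⁆ ∈ W) (hm : ∀ v ∈ W, ⁅Jminus A n E, v⁆ ∈ W) {x : KM A}
    (hx : x ∈ so21 A n E) : ∀ v ∈ W, ⁅x, v⁆ ∈ W := by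
  have hle : so21 A n E ≤ stabilizer W := LieSubalgebra.lieSpan_le.2 (by
    rintro _ (rfl | rfl | rfl)
    exacts [h3, hp, hm])
  exact hle hx

theorem lie_mem_of_mem_generators (V : LieSubmodule ℂ (so21 A n E) (KM A)) {x : KM A}
    (hx : x ∈ ({J3 A n, Jplus A n E, Jminus A n E} : Set (KM A))) {v : KM A} (hv : v ∈ V) :
    ⁅x, v⁆ ∈ V :=
  V.lie_mem (x := ⟨x, LieSubalgebra.subset_lieSpan hx⟩) hv

theorem eq_bot_or_eq_of_stable {V : LieSubmodule ℂ (so21 A n E) (KM A)}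
    (hV : LieModule.IsIrreducible ℂ (so21 A n E) V) (W : Submodule ℂ (KM A))
    (hW : W ≤ V.toSubmodule) (hp : ∀ v ∈ W, ⁅Jplus A n E, v⁆ ∈ W)
    (hm : ∀ v ∈ W, ⁅Jminus A n E, v⁆ ∈ W) (h3 : ∀ v ∈ W, ⁅J3 A n, v⁆ ∈ W) :
    W = ⊥ ∨ W = V.toSubmodule := by
  let N : LieSubmodule ℂ (so21 A n E) V :=
    { W.comap V.toSubmodule.subtype with
      lie_mem := fun {x v} hv => lie_mem_of_mem_so21 h3 hp hm x.2 _ hv }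
  rcases IsSimpleOrder.eq_bot_or_eq_top N with hN | hN
  · refine Or.inl ((Submodule.eq_bot_iff _).2 fun v hv => ?_)
    have h1 : (⟨v, hW hv⟩ : V) ∈ N := hv
    rw [hN, LieSubmodule.mem_bot] at h1
    exact congrArg Subtype.val h1
  · refine Or.inr (le_antisymm hW fun v hv => ?_)
    have h1 : (⟨v, hv⟩ : V) ∈ N := hN ▸ LieSubmodule.mem_top _
    exact h1

/-- The normalization factor of `J⁺` and `J⁻` does not vanish as soon as a principal series exists:
otherwise an irreducible module would be spanned by one eigenvector of `J₃`. -/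
theorem IsPrincipalSeries.scale_ne_zero {V : LieSubmodule ℂ (so21 A n E) (KM A)} {s : ℂ}
    (P : IsPrincipalSeries A n E V s) : scale A n E ≠ 0 := by
  intro h0
  have hp : ∀ v : KM A, ⁅Jplus A n E, v⁆ = 0 := fun v => by rw [Jplus, h0, zero_smul, zero_lie]
  have hm : ∀ v : KM A, ⁅Jminus A n E, v⁆ = 0 := fun v => by rw [Jminus, h0, zero_smul, zero_lie]
  obtain ⟨t, -, v, hv, hv0, hvt⟩ := P.unbounded_above 0
  obtain ⟨t', ht, w, hw, hw0, hwt⟩ := P.unbounded_above t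
  have hspan := eq_span_of_eigenvectors (X := LieAlgebra.ad ℂ _ (Jplus A n E))
    (Y := LieAlgebra.ad ℂ _ (Jminus A n E)) (H := LieAlgebra.ad ℂ _ (J3 A n))
    (eq_bot_or_eq_of_stable P.irreducible) (fun _ : Unit => v) (fun _ => (t : ℂ))
    (fun _ => hv) (fun _ => hvt) (fun _ => by rw [LieAlgebra.ad_apply, hp]; exact zero_mem _)
    (fun _ => by rw [LieAlgebra.ad_apply, hm]; exact zero_mem _) ⟨(), hv0⟩
  obtain ⟨-, htt⟩ := exists_eigenvalue_eq_of_mem_span (LieAlgebra.ad ℂ _ (J3 A n))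
    (fun _ : Unit => v) (fun _ => (t : ℂ)) (fun _ => hvt) (hspan ▸ hw) hw0 hwt
  exact ht.ne' (by exact_mod_cast htt)

/-- A principal series representation in `𝔤`, in terms of the operators `ad J⁺`, `ad J⁻`, `ad J₃`. -/
theorem IsPrincipalSeries.isPrincipal {V : LieSubmodule ℂ (so21 A n E) (KM A)} {s : ℂ}
    (P : IsPrincipalSeries A n E V s) (hinj : Function.Injective (zWeight A))
    (hn : normSq A n ≠ 0) (hE : E ∈ rootSpace A (latticeWeight A n)) :
    IsPrincipal (LieAlgebra.ad ℂ (KM A) (Jplus A n E)) (LieAlgebra.ad ℂ (KM A) (Jminus A n E))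
      (LieAlgebra.ad ℂ (KM A) (J3 A n)) V.toSubmodule where
  X_Y v := by
    simp only [LieAlgebra.ad_apply]
    rw [leibniz_lie, lie_Jplus_Jminus hinj hn hE P.scale_ne_zero, neg_lie, neg_add_eq_sub]
  H_X v := by
    simp only [LieAlgebra.ad_apply]
    rw [leibniz_lie, lie_J3_Jplus hn hE, add_comm]
  H_Y v := by
    simp only [LieAlgebra.ad_apply]
    rw [leibniz_lie, lie_J3_Jminus hn hE, neg_lie, neg_add_eq_sub]
  X_mem v hv := lie_mem_of_mem_generators V (by simp) hv
  Y_mem v hv := lie_mem_of_mem_generators V (by simp) hv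
  irreducible := eq_bot_or_eq_of_stable P.irreducible
  casimir := ⟨_, P.casimir_eq⟩
  unbounded_above := P.unbounded_above
  unbounded_below := P.unbounded_below

/-! ### Strings of weights and the finiteness of the decomposition -/

/-- If `ad y`, of degree `-a`, inverts `ad x` up to non-zero factors on a spanning set of `V`, then
a weight `β` of `V` yields the weight `a + β`: on a member of the spanning set with non-zero
`β`-component, `ad y` maps the `(a + β)`-component of the image under `ad x` to a non-zero multiple
of that `β`-component. -/
theorem add_mem_weightsOf {V : Submodule ℂ (KM A)} {σ : Type*} {v : σ → KM A}
    (hspan : V = Submodule.span ℂ (Set.range v)) {a : ι → ℂ} {x y : KM A}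
    (hy : y ∈ rootSpace A (-a)) (hxV : ∀ w ∈ V, ⁅x, w⁆ ∈ V)
    (hyx : ∀ k, ∃ q : ℂ, q ≠ 0 ∧ ⁅y, ⁅x, v k⁆⁆ = q • v k) {β : ι → ℂ}
    (hβ : β ∈ weightsOf A V) : a + β ∈ weightsOf A V := by
  obtain ⟨w, hw, hwβ⟩ := (mem_weightsOf_iff A V β).1 hβ
  obtain ⟨k, hk⟩ : ∃ k, component A β (v k) ≠ 0 := by
    by_contra! h0
    have hle : V ≤ LinearMap.ker (component A β) := by
      rw [hspan, Submodule.span_le]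
      rintro _ ⟨k, rfl⟩
      exact h0 k
    exact hwβ (hle hw)
  obtain ⟨q, hq, hqv⟩ := hyx k
  refine (mem_weightsOf_iff A V _).2
    ⟨⁅x, v k⁆, hxV _ (hspan ▸ Submodule.subset_span (Set.mem_range_self k)),
      fun h0 => smul_ne_zero hq hk ?_⟩
  rw [← map_smul, ← hqv, ← neg_add_cancel_left a β, component_lie A hy, h0, lie_zero]

/-- The weights of a principal series representation are stable under translation by `α`. -/
theorem IsPrincipalSeries.add_zsmul_mem_weightsOf {V : LieSubmodule ℂ (so21 A n E) (KM A)} {s : ℂ}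
    (P : IsPrincipalSeries A n E V s) (hinj : Function.Injective (zWeight A))
    (hn : normSq A n ≠ 0) (hE : E ∈ rootSpace A (latticeWeight A n)) {β : ι → ℂ}
    (hβ : β ∈ weightsOf A V.toSubmodule) (k : ℤ) :
    β + k • latticeWeight A n ∈ weightsOf A V.toSubmodule := by
  have Q := P.isPrincipal hinj hn hE
  obtain ⟨v, hv, hv0, t, hvt⟩ := Q.exists_eigenvector
  have hne : ∀ j : ℕ, (LieAlgebra.ad ℂ (KM A) (Jplus A n E) ^ j) v ≠ 0 ∧
      (LieAlgebra.ad ℂ (KM A) (Jminus A n E) ^ j) v ≠ 0 := fun j => by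
    induction j with
    | zero => exact ⟨hv0, hv0⟩
    | succ j ih =>
      rw [pow_succ', pow_succ', Module.End.mul_apply, Module.End.mul_apply]
      exact ⟨Q.X_ne_zero (Q.X_pow_mem hv j) ih.1 (Q.H_X_pow hvt j),
        Q.Y_ne_zero (Q.Y_pow_mem hv j) ih.2 (Q.H_Y_pow hvt j)⟩
  have hspan := Q.eq_span_pow hv hv0 hvt
  have hup : ∀ γ ∈ weightsOf A V.toSubmodule,
      latticeWeight A n + γ ∈ weightsOf A V.toSubmodule := fun γ hγ => by
    refine add_mem_weightsOf hspan (Jminus_mem_rootSpace hE) Q.X_mem ?_ hγ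
    rintro (j | j)
    · exact Q.exists_Y_X_eq_smul_ne_zero (Q.X_pow_mem hv j) (hne j).1 (Q.H_X_pow hvt j)
    · exact Q.exists_Y_X_eq_smul_ne_zero (Q.Y_pow_mem hv j) (hne j).2 (Q.H_Y_pow hvt j)
  have hdown : ∀ γ ∈ weightsOf A V.toSubmodule,
      -latticeWeight A n + γ ∈ weightsOf A V.toSubmodule := fun γ hγ => by
    refine add_mem_weightsOf hspan
      ((neg_neg (latticeWeight A n)).symm ▸ Jplus_mem_rootSpace hE) Q.Y_mem ?_ hγ
    rintro (j | j)
    · exact Q.swap.exists_Y_X_eq_smul_ne_zero (Q.X_pow_mem hv j) (hne j).1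
        (Q.swap.H_Y_pow (t := -t) (by rw [LinearMap.neg_apply, hvt, neg_smul]) j)
    · exact Q.swap.exists_Y_X_eq_smul_ne_zero (Q.Y_pow_mem hv j) (hne j).2
        (Q.swap.H_X_pow (t := -t) (by rw [LinearMap.neg_apply, hvt, neg_smul]) j)
  induction k using Int.induction_on with
  | zero => simpa using hβ
  | succ k ih =>
    convert hup _ ih using 1
    rw [add_zsmul, one_zsmul]
    abel
  | pred k ih =>
    convert hdown _ ih using 1
    rw [sub_zsmul, one_zsmul]
    abel

/-- If `V` contains a weight vector, then its weights lie in one string. -/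
theorem IsPrincipalSeries.exists_eq_add_zsmul {V : LieSubmodule ℂ (so21 A n E) (KM A)} {s : ℂ}
    (P : IsPrincipalSeries A n E V s) (hinj : Function.Injective (zWeight A))
    (hn : normSq A n ≠ 0) (hE : E ∈ rootSpace A (latticeWeight A n)) {β : ι → ℂ} {v : KM A}
    (hv : v ∈ V) (hv0 : v ≠ 0) (hvβ : v ∈ rootSpace A β) {l : ι → ℂ}
    (hl : l ∈ weightsOf A V.toSubmodule) : ∃ k : ℤ, β + k • latticeWeight A n = l := by
  have Q := P.isPrincipal hinj hn hE
  have hpow : ∀ (x : KM A) (a : ι → ℂ), x ∈ rootSpace A a → ∀ j : ℕ,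
      (LieAlgebra.ad ℂ (KM A) x ^ j) v ∈ rootSpace A (β + j • a) := fun x a hx j => by
    induction j with
    | zero => simpa using hvβ
    | succ j ih =>
      rw [pow_succ', Module.End.mul_apply, LieAlgebra.ad_apply]
      convert lie_mem_rootSpace A hx ih using 2
      rw [succ_nsmul]
      abel
  by_contra! hne
  refine hl ((Q.eq_span_pow hv hv0 (lie_J3 hvβ)).trans_le (Submodule.span_le.2 ?_))
  rintro _ ⟨j | j, rfl⟩
  · refine Submodule.mem_iSup_of_mem
      (p := fun m : {m : ι → ℂ // m ≠ l} => rootSpace A m.1) ⟨_, hne j⟩ ?_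
    simpa using hpow _ _ (Jplus_mem_rootSpace hE) j
  · refine Submodule.mem_iSup_of_mem
      (p := fun m : {m : ι → ℂ // m ≠ l} => rootSpace A m.1) ⟨_, hne (-j)⟩ ?_
    simpa using hpow _ _ (Jminus_mem_rootSpace hE) j

/-- A slab contains only finitely many weights: these are lattice vectors of norm at most two whose
product with the timelike vector `α` is bounded. -/
theorem IsHyperbolic.finite_slab_inter_roots (hA : IsHyperbolic A)
    (hinj : Function.Injective (zWeight A)) (hn : normSq A n < 0) (c : ℝ) :
    (slab A n c ∩ (roots A ∪ {0})).Finite := by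
  have hn' : latticeForm A (fun j => (n j : ℤ)) (fun j => (n j : ℤ)) < 0 := by
    rwa [← normSq_eq_latticeForm]
  refine ((hA.finite_bounded hn' ⌈(|c| + 1) * |(normSq A n : ℝ)|⌉).image (zWeight A)).subset ?_
  rintro l ⟨⟨hl1, hl2⟩, hl⟩
  obtain ⟨b, rfl, hb⟩ : ∃ b, zWeight A b = l ∧ latticeForm A b b ≤ 2 := by
    rcases hl with hl | hl
    · exact exists_zWeight_eq_of_rootSpace_ne_bot hA hinj hl.2
    · refine ⟨0, ?_, by simp [latticeForm]⟩
      rw [map_zero, Set.mem_singleton_iff.1 hl]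
  refine ⟨b, ⟨hb, ?_⟩, rfl⟩
  set d := latticeForm A (fun j => (n j : ℤ)) b
  have hre : (level A n (zWeight A b)).re = (d : ℝ) / (normSq A n : ℝ) := by
    rw [level_zWeight, ← Complex.ofReal_intCast, ← Complex.ofReal_intCast, ← Complex.ofReal_div,
      Complex.ofReal_re]
  rw [hre] at hl1 hl2
  have hn0 : (normSq A n : ℝ) ≠ 0 := by exact_mod_cast hn.ne
  have habs : |(d : ℝ) / (normSq A n : ℝ)| ≤ |c| + 1 :=
    abs_le.2 ⟨by linarith [neg_abs_le c], by linarith [le_abs_self c]⟩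
  rw [abs_div, div_le_iff₀ (abs_pos.2 hn0)] at habs
  have h1 : ((|d| : ℤ) : ℝ) ≤ (⌈(|c| + 1) * |(normSq A n : ℝ)|⌉ : ℤ) := by
    rw [Int.cast_abs]
    exact habs.trans (Int.le_ceil _)
  exact_mod_cast h1

/-- Eigenvectors of `J₃` with eigenvalue in `[0, 1]` lie in the sum of the weight spaces of one
slab. -/
theorem mem_iSup_slab {x : KM A} {t : ℝ} (ht0 : 0 ≤ t) (ht1 : t ≤ 1)
    (hx : ⁅J3 A n, x⁆ = (t : ℂ) • x) :
    x ∈ ⨆ l : (slab A n 0 ∩ (roots A ∪ {0}) : Set (ι → ℂ)), rootSpace A l.1 := by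
  obtain ⟨S, hS⟩ := exists_eq_sum_component A x
  rw [hS]
  refine Submodule.sum_mem _ fun l _ => ?_
  by_cases hl : component A l x = 0
  · rw [hl]
    exact Submodule.zero_mem _
  have h1 : level A n l • component A l x = (t : ℂ) • component A l x := by
    rw [← lie_J3 (component_mem A l x), ← component_lie A (J3_mem_rootSpace A n), hx, map_smul,
      zero_add]
  have h2 : level A n l = t := smul_left_injective ℂ hl h1
  refine Submodule.mem_iSup_of_mem (p := fun l : (slab A n 0 ∩ (roots A ∪ {0}) : Set (ι → ℂ)) =>
    rootSpace A l.1) ⟨l, ⟨?_, ?_⟩, ?_⟩ (component_mem A l x)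
  · rw [h2, Complex.ofReal_re]; exact ht0
  · rw [h2, Complex.ofReal_re]; linarith
  · exact mem_roots_union_zero A ((Submodule.ne_bot_iff _).2 ⟨_, component_mem A l x, hl⟩)

/-- The principal series summands of a direct sum contribute linearly independent vectors to the
finite-dimensional sum of the weight spaces of a slab. -/
theorem IsHyperbolic.finite_principalSeries (hA : IsHyperbolic A)
    (hinj : Function.Injective (zWeight A)) (hn : normSq A n < 0)
    (hE : E ∈ rootSpace A (latticeWeight A n)) {κ : Type*}
    (V : κ → LieSubmodule ℂ (so21 A n E) (KM A)) (hV : iSupIndep V) :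
    {i : κ | ∃ s : ℂ, IsPrincipalSeries A n E (V i) s}.Finite := by
  set U : Submodule ℂ (KM A) :=
    ⨆ l : (slab A n 0 ∩ (roots A ∪ {0}) : Set (ι → ℂ)), rootSpace A l.1 with hU
  have hfin : Finite (slab A n 0 ∩ (roots A ∪ {0}) : Set (ι → ℂ)) :=
    (hA.finite_slab_inter_roots hinj hn 0).to_subtype
  have hfd : ∀ l : (slab A n 0 ∩ (roots A ∪ {0}) : Set (ι → ℂ)),
      FiniteDimensional ℂ (rootSpace A l.1) := fun l => finiteDimensional_rootSpace hinj l.1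
  have hUfd : FiniteDimensional ℂ U := Submodule.finiteDimensional_iSup _
  have hex : ∀ i : {i : κ | ∃ s : ℂ, IsPrincipalSeries A n E (V i) s},
      ∃ x ∈ (V i.1).toSubmodule, x ≠ 0 ∧ x ∈ U := by
    rintro ⟨i, s, P⟩
    obtain ⟨t, ht0, ht1, x, hx, hx0, hxt⟩ :=
      (P.isPrincipal hinj hn.ne hE).exists_eigenvector_mem_Icc
    exact ⟨x, hx, hx0, mem_iSup_slab ht0 ht1 hxt⟩
  choose x hxV hx0 hxU using hex
  have hind : iSupIndep fun i : {i : κ | ∃ s : ℂ, IsPrincipalSeries A n E (V i) s} =>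
      (V i.1).toSubmodule :=
    (LieSubmodule.iSupIndep_toSubmodule.2 hV).comp Subtype.val_injective
  have hli : LinearIndependent ℂ x := hind.linearIndependent _ hxV hx0
  have hli' : LinearIndependent ℂ fun i => (⟨x i, hxU i⟩ : U) :=
    LinearIndependent.of_comp U.subtype hli
  have := hli'.finite
  exact Set.toFinite _

end So21

end KacMoody

theorem mainTheorem2 {ι : Type*} [Fintype ι] [DecidableEq ι] (A : Matrix ι ι ℤ)
    (hA : KacMoody.IsHyperbolic A)
    -- the positive timelike root `α = ∑ j, n j • α_j` and a root vector `E` for it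
    (n : ι → ℕ) (hn : KacMoody.normSq A n < 0)
    (hroot : KacMoody.latticeWeight A n ∈ KacMoody.roots A)
    (E : KacMoody.KM A) (hE : E ∈ KacMoody.rootSpace A (KacMoody.latticeWeight A n))
    (hE0 : E ≠ 0) :
    -- only finitely many elements of `Δ ∪ {0}` lie in a slab of width `α` orthogonal to `α`
    (∀ c : ℝ, (KacMoody.slab A n c ∩ (KacMoody.roots A ∪ {0})).Finite) ∧
    -- every string `β + kα` meets every such slab
    (∀ (β : ι → ℂ) (c : ℝ), ∃ k : ℤ, β + k • KacMoody.latticeWeight A n ∈ KacMoody.slab A n c) ∧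
    -- the weights of a principal series representation form full strings in `Δ ∪ {0}`
    (∀ (V : LieSubmodule ℂ (KacMoody.so21 A n E) (KacMoody.KM A)) (s : ℂ),
      KacMoody.IsPrincipalSeries A n E V s →
        (KacMoody.weightsOf A V.toSubmodule).Nonempty ∧
        ∀ β ∈ KacMoody.weightsOf A V.toSubmodule, ∀ k : ℤ,
          β + k • KacMoody.latticeWeight A n ∈ KacMoody.weightsOf A V.toSubmodule ∧
          β + k • KacMoody.latticeWeight A n ∈ KacMoody.roots A ∪ {0}) ∧
    -- and exactly one full string if the representation is spanned by weight vectors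
    (∀ (V : LieSubmodule ℂ (KacMoody.so21 A n E) (KacMoody.KM A)) (s : ℂ),
      KacMoody.IsPrincipalSeries A n E V s →
      (∀ i, ∀ x ∈ V, ⁅KacMoody.h A i, x⁆ ∈ V) →
        ∃ β : ι → ℂ, KacMoody.weightsOf A V.toSubmodule =
          Set.range (fun k : ℤ => β + k • KacMoody.latticeWeight A n)) ∧
    -- in a direct sum of submodules of `𝔤(A)` only finitely many summands are principal series
    (∀ (κ : Type*) (V : κ → LieSubmodule ℂ (KacMoody.so21 A n E) (KacMoody.KM A)),
      iSupIndep V → {i : κ | ∃ s : ℂ, KacMoody.IsPrincipalSeries A n E (V i) s}.Finite) := by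
  have hn' : KacMoody.latticeForm A (fun j => (n j : ℤ)) (fun j => (n j : ℤ)) < 0 := by
    rwa [← KacMoody.normSq_eq_latticeForm]
  have hinj := hA.zWeight_injective hn'
  refine ⟨hA.finite_slab_inter_roots hinj hn, KacMoody.exists_zsmul_mem_slab hn.ne,
    fun V s P => ⟨?_, fun β hβ k => ?_⟩, fun V s P hV => ?_,
    fun κ V hV => hA.finite_principalSeries hinj hn hE V hV⟩
  · obtain ⟨v, hv, hv0, -⟩ := (P.isPrincipal hinj hn.ne hE).exists_eigenvector
    exact KacMoody.weightsOf_nonempty A hv hv0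
  · have hk := P.add_zsmul_mem_weightsOf hinj hn.ne hE hβ k
    exact ⟨hk, KacMoody.mem_roots_union_zero A (KacMoody.rootSpace_ne_bot_of_mem_weightsOf A hk)⟩
  · obtain ⟨v, hv, hv0, -⟩ := (P.isPrincipal hinj hn.ne hE).exists_eigenvector
    obtain ⟨β, hβ⟩ := KacMoody.weightsOf_nonempty A hv hv0
    obtain ⟨x, hx, hxβ⟩ := (KacMoody.mem_weightsOf_iff A _ β).1 hβ
    refine ⟨β, Set.Subset.antisymm (fun l hl => ?_) ?_⟩
    · exact P.exists_eq_add_zsmul hinj hn.ne hE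
        (KacMoody.component_mem_of_stable A (V := V.toSubmodule) hV hx β) hxβ
        (KacMoody.component_mem A β x) hl
    · rintro _ ⟨k, rfl⟩
      exact P.add_zsmul_mem_weightsOf hinj hn.ne hE hβ k
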